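/- Let $K$ be a global field (a number field, or a finite extension of $\mathbb{F}_q(t)$ for a finite field $\mathbb{F}_q$) with $\operatorname{char} K\neq 2,3,5$. Let $R$ be either the adèle ring $\mathbb{A}$ of $K$, or a product $\prod_{\mathfrak p\in\mathcal P}\mathfrak o_{\mathfrak p}$, where $\mathcal P$ is any non-empty set of places of $K$, $\mathfrak o_{\mathfrak p}$ denotes the valuation ring of the completion $K_{\mathfrak p}$ if $\mathfrak p$ is non-archimedean, and $\mathfrak o_{\mathfrak p}=K_{\mathfrak p}$ if $\mathfrak p$ is archimedean. Then the ring $R$ (in the first-order language of rings) is bi-interpretable, with parameters, with each of the groups $\mathrm{SL}_2(R)$, $\mathrm{SL}_2(R)/\langle -1\rangle$ and $\mathrm{PSL}_2(R)=\mathrm{SL}_2(R)/\mathrm{Z}(\mathrm{SL}_2(R))$ (in the first-order language of groups). Here an interpretation of a structure $N$ in a structure $M$ is a surjection $f$ onto $N$ from a definable set $D$ of $d$-tuples of $M$ such that the preimages under $f$ of equality, of the graphs of the basic functions and of the basic relations of $N$ are definable in $M$. The structures $M$ and $N$ are bi-interpretable if there are interpretations of $N$ in $M$ and of $M$ in $N$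 such that the graphs of the two composite partial maps, from tuples of $M$ onto $M$ and from tuples of $N$ onto $N$, are definable in $M$ and in $N$ respectively. Definable means definable by a first-order formula with parameters. -/

import Mathlib

namespace AdelicSL2

open FirstOrder IsDedekindDomain
open scoped RestrictedProduct MatrixGroups NumberField

/-! ### Interpretations and bi-interpretations of first-order structures -/

section ModelTheory

/-- The set of `κ`-indexed families of `d`-tuples from `M`, all of them lying in `D`, whose family
of images under `f` lies in `s`. -/
def pullback {M N : Type*} {d : ℕ} (D : Set (Fin d → M)) (f : (Fin d → M) → N)
    {κ : Type*} (s : Set (κ → N)) : Set (κ × Fin d → M) :=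
  {x | (∀ k, (fun i => x (k, i)) ∈ D) ∧ (fun k => f fun i => x (k, i)) ∈ s}

/-- An interpretation (with parameters) of the `L'`-structure `N` in the `L`-structure `M`:
a definable set `dom` of `dim`-tuples from `M` and a map from `dom` onto `N` such that the
preimages of equality, of the graphs of the basic functions and of the basic relations of `N` are
definable in `M`. Parameters from `M` are allowed, and the values of `toFun` outside `dom` are
irrelevant. -/
structure Interpretation (L L' : FirstOrder.Language) (M N : Type*) [L.Structure M] [L'.Structure N] where
  /-- the dimension of the interpretation -/
  dim : ℕ
  /-- the domain of the coordinate map -/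
  dom : Set (Fin dim → M)
  /-- the coordinate map -/
  toFun : (Fin dim → M) → N
  surjOn : Set.SurjOn toFun dom Set.univ
  definable_dom : (Set.univ : Set M).Definable L dom
  definable_eq : (Set.univ : Set M).Definable L
    (pullback dom toFun {y : Fin 2 → N | y 0 = y 1})
  definable_fun : ∀ (n : ℕ) (g : L'.Functions n), (Set.univ : Set M).Definable L
    (pullback dom toFun {y : Fin (n + 1) → N |
      FirstOrder.Language.Structure.funMap g (Fin.init y) = y (Fin.last n)})
  definable_rel : ∀ (n : ℕ) (r : L'.Relations n), (Set.univ : Set M).Definable L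
    (pullback dom toFun {y : Fin n → N | FirstOrder.Language.Structure.RelMap r y})

/-- The graph of the composite of the coordinate maps of an interpretation `I` of `N` in `M` and an
interpretation `J` of `M` in `N`: the pairs consisting of a `J.dim`-tuple of `I.dim`-tuples from
`M` on which the composite is defined, and of the element of `M` which it represents. -/
def compGraph {L L' : FirstOrder.Language} {M N : Type*} [L.Structure M] [L'.Structure N]
    (I : Interpretation L L' M N) (J : Interpretation L' L N M) :
    Set ((Fin J.dim × Fin I.dim) ⊕ Unit → M) :=
  {x | (fun p => x (Sum.inl p)) ∈ pullback I.dom I.toFun J.dom ∧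
    J.toFun (fun j => I.toFun fun i => x (Sum.inl (j, i))) = x (Sum.inr ())}

/-- `M` and `N` are bi-interpretable (with parameters): there are an interpretation of `N` in `M`
and one of `M` in `N` such that the isomorphism between `M` and the copy of `M` inside the copy of
`N` in `M` is definable in `M`, and likewise with `M` and `N` exchanged. -/
def BiInterpretable (L L' : FirstOrder.Language) (M N : Type*) [L.Structure M] [L'.Structure N] : Prop :=
  ∃ (I : Interpretation L L' M N) (J : Interpretation L' L N M),
    (Set.univ : Set M).Definable L (compGraph I J) ∧
    (Set.univ : Set N).Definable L' (compGraph J I)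

/-- The function symbols of the language of groups. -/
inductive GroupFunc : ℕ → Type
  | mul : GroupFunc 2
  | inv : GroupFunc 1
  | one : GroupFunc 0

/-- The first-order language of groups. -/
def groupLang : FirstOrder.Language.{0, 0} where
  Functions := GroupFunc
  Relations := fun _ => Empty

/-- A group as a structure for the language of groups. -/
@[reducible]
def groupStructure (G : Type*) [Group G] : groupLang.Structure G where
  funMap := fun {n} g =>
    match n, g with
    | _, .mul => fun x => x 0 * x 1
    | _, .inv => fun x => (x 0)⁻¹
    | _, .one => fun _ => 1
  RelMap := fun r _ => r.elim

/-- The ring `R` (in the language of rings) is bi-interpretable with the group `G` (in the language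
of groups). -/
def RingGroupBiInterpretable (R G : Type*) [CommRing R] [Group G] : Prop :=
  letI := FirstOrder.Ring.compatibleRingOfRing R
  letI := groupStructure G
  BiInterpretable FirstOrder.Language.ring groupLang R G

end ModelTheory

/-! ### The groups -/

section Groups

/-- The subgroup `⟨-1⟩` of `SL₂(R)` is normal. -/
instance zpowers_neg_one_normal (R : Type*) [CommRing R] :
    (Subgroup.zpowers (-1 : SL(2, R))).Normal where
  conj_mem x hx g := by
    obtain ⟨k, rfl⟩ := Subgroup.mem_zpowers_iff.1 hx
    have h : Commute g ((-1 : SL(2, R)) ^ k) := ((Commute.one_right g).neg_right).zpow_right k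
    rw [h.eq, mul_inv_cancel_right]
    exact hx

/-- `R` is bi-interpretable with each of `SL₂(R)`, `SL₂(R)/⟨-1⟩` and `PSL₂(R)`, the last of which
is `SL₂(R)` modulo its centre. -/
def BiInterpretableWithSL2 (R : Type*) [CommRing R] : Prop :=
  RingGroupBiInterpretable R SL(2, R) ∧
  RingGroupBiInterpretable R (SL(2, R) ⧸ Subgroup.zpowers (-1 : SL(2, R))) ∧
  RingGroupBiInterpretable R (Matrix.ProjectiveSpecialLinearGroup (Fin 2) R)

end Groups

/-! ### Number fields -/

section NumberField

variable (K : Type*) [Field K] [NumberField K]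

/-- The places of a number field, archimedean or not. -/
abbrev NFPlace := NumberField.InfinitePlace K ⊕ HeightOneSpectrum (𝓞 K)

/-- The local ring `𝔬_v` at a place `v` of a number field: the valuation ring of the completion
if `v` is non-archimedean, and the whole completion if `v` is archimedean. -/
def NFLocalRing : NFPlace K → Type _
  | .inl v => v.Completion
  | .inr v => v.adicCompletionIntegers K

noncomputable instance (v : NFPlace K) : CommRing (NFLocalRing K v) :=
  match v with
  | .inl v => inferInstanceAs (CommRing v.Completion)
  | .inr v => inferInstanceAs (CommRing (v.adicCompletionIntegers K))

end NumberField

/-! ### Function fields -/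

section FunctionField

/-- The places of a global function field, given by its nontrivial valuation rings (all of which
are discrete valuation rings). -/
abbrev FFPlace (K : Type*) [Field K] := {A : ValuationSubring K // A ≠ ⊤}

variable {K : Type*} [Field K]

/-- The completion of `K` at a place. -/
abbrev FFCompletion (v : FFPlace K) : Type _ := v.1.valuation.Completion

/-- The valuation ring of the completion of `K` at a place. -/
noncomputable def ffIntegers (v : FFPlace K) : ValuationSubring (FFCompletion v) :=
  (Valued.v : Valuation (FFCompletion v) v.1.ValueGroup).valuationSubring

/-- The adèle ring of a global function field `K`: the restricted product of the completions of `K`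
at all its places with respect to their valuation rings. -/
abbrev FFAdeleRing (K : Type*) [Field K] : Type _ :=
  Πʳ v : FFPlace K, [FFCompletion v, ffIntegers v]

end FunctionField

end AdelicSL2

/-! All three groups are images of a surjection `π` from `SL₂(R)` whose kernel consists of scalars
and is definable in matrix entries. Matrix entries therefore interpret each group `G` in `R`. The
work lies in recovering `R` from `G` and in comparing the two interpretations.

For `R` inside `G`, the centraliser of `π (upper 1)` consists of the images of `z * upper t` with `z
* z = 1`, and such an element stands for `t`. Addition is the group law, and two elements have equal
value when their quotient also commutes with `π (lower 1)`. Conjugation by the image of `diag(r,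
r⁻¹)` multiplies values by `r ^ 2`. Since `24 * s` is an alternating sum of four squares of units,
the conjugations that take `1` to `24 * s` take `r` to `24 * r * s`. As `24` is not a zero divisor,
this defines multiplication (`UnitSquareRing.isProduct_iff`).

The composite on `R` is read off the entries. The composite on `G` needs a formula linking `g` to
the entries of a matrix above it. Every matrix is a product lower, upper, lower, upper, with entries
polynomial in the four factors, so it suffices to define the exact images of the matrices `upper t`,
free of the ambiguous scalar. Squaring removes that scalar and reaches `2 * R`; finitely many
parameters representing `R` modulo `2` do the rest (`UnitSquareRing.isUpper_iff`,
`UnitSquareRing.isImage_iff`).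

The ring properties used are collected in `UnitSquareRing`. The unit-square identity and the unit
condition behind the factorisation hold in every local ring, and pass to products and restricted
products coordinatewise because the local choices can be made integral wherever the data are.
Finiteness modulo `2` holds because `2` is a unit at almost all places and the remaining integer
rings are finite modulo `2`. -/

namespace AdelicSL2

open FirstOrder IsDedekindDomain
open scoped RestrictedProduct MatrixGroups NumberField

/-! ### Definability of predicates and terms, with parameters -/

section Definability

variable {L : FirstOrder.Language.{0, 0}} {M : Type*} [L.Structure M] {α β : Type*}

/-- The predicate `P` on families of elements of `M` is definable with parameters. -/
def DefPred (L : FirstOrder.Language.{0, 0}) {M : Type*} [L.Structure M] {α : Type*}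
    (P : (α → M) → Prop) : Prop :=
  (Set.univ : Set M).Definable L {x | P x}

/-- The function `f` on families of elements of `M` is given by a term with parameters. -/
def DefTerm (L : FirstOrder.Language.{0, 0}) {M : Type*} [L.Structure M] {α : Type*}
    (f : (α → M) → M) : Prop :=
  ∃ φ : (L[[(Set.univ : Set M)]]).Term α, ∀ x, f x = φ.realize x

theorem DefTerm.var (i : α) : DefTerm L fun x : α → M => x i :=
  ⟨Language.Term.var i, fun _ => rfl⟩

theorem DefTerm.const (a : M) : DefTerm L fun _ : α → M => a :=
  ⟨(L.con (⟨a, trivial⟩ : (Set.univ : Set M))).term, fun _ => rfl⟩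

theorem DefTerm.subst {f : (α → M) → M} (hf : DefTerm L f) {t : (β → M) → α → M}
    (ht : ∀ a, DefTerm L fun x => t x a) : DefTerm L fun x => f (t x) := by
  obtain ⟨φ, hφ⟩ := hf
  choose ψ hψ using ht
  refine ⟨φ.subst ψ, fun x => ?_⟩
  have h : t x = fun a => (ψ a).realize x := funext fun a => hψ a x
  exact (hφ (t x)).trans ((congrArg (fun y => φ.realize y) h).trans Language.Term.realize_subst.symm)

theorem DefTerm.lift {f : (α → M) → M} (hf : DefTerm L f) :
    DefTerm L fun x : α ⊕ β → M => f fun i => x (Sum.inl i) :=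
  hf.subst (t := fun x i => x (Sum.inl i)) fun a => DefTerm.var (Sum.inl a)

theorem DefTerm.fun₁ (g : L.Functions 1) {f : (α → M) → M} (hf : DefTerm L f) :
    DefTerm L fun x => Language.Structure.funMap g ![f x] := by
  obtain ⟨φ, hφ⟩ := hf
  refine ⟨Language.Functions.apply₁ ((L.lhomWithConstants (Set.univ : Set M)).onFunction g) φ, fun x => ?_⟩
  exact (congrArg (fun y => Language.Structure.funMap g ![y]) (hφ x)).trans
    ((Language.LHom.map_onFunction (L.lhomWithConstants (Set.univ : Set M)) g _).symm.trans
      Language.Term.realize_functions_apply₁.symm)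

theorem DefTerm.fun₂ (g : L.Functions 2) {f f' : (α → M) → M} (hf : DefTerm L f)
    (hf' : DefTerm L f') : DefTerm L fun x => Language.Structure.funMap g ![f x, f' x] := by
  obtain ⟨φ, hφ⟩ := hf
  obtain ⟨φ', hφ'⟩ := hf'
  refine ⟨Language.Functions.apply₂ ((L.lhomWithConstants (Set.univ : Set M)).onFunction g) φ φ', fun x => ?_⟩
  exact (congrArg₂ (fun y z => Language.Structure.funMap g ![y, z]) (hφ x) (hφ' x)).trans
    ((Language.LHom.map_onFunction (L.lhomWithConstants (Set.univ : Set M)) g _).symm.trans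
      Language.Term.realize_functions_apply₂.symm)

theorem DefPred.congr {P Q : (α → M) → Prop} (hP : DefPred L P) (h : ∀ x, Q x ↔ P x) :
    DefPred L Q := by
  have : Q = P := funext fun x => propext (h x)
  rwa [this]

theorem DefPred.and {P Q : (α → M) → Prop} (hP : DefPred L P) (hQ : DefPred L Q) :
    DefPred L fun x => P x ∧ Q x :=
  Set.Definable.inter hP hQ

theorem DefPred.or {P Q : (α → M) → Prop} (hP : DefPred L P) (hQ : DefPred L Q) :
    DefPred L fun x => P x ∨ Q x :=
  Set.Definable.union hP hQ

theorem DefPred.ex {P : (α → M) → M → Prop}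
    (h : DefPred L fun x : α ⊕ Fin 1 → M => P (fun i => x (Sum.inl i)) (x (Sum.inr 0))) :
    DefPred L fun x => ∃ y, P x y := by
  have := Set.Definable.exists_of_finite h
  refine DefPred.congr (P := fun x => _) this fun x => ?_
  constructor
  · rintro ⟨y, hy⟩
    exact ⟨fun _ => y, hy⟩
  · rintro ⟨u, hu⟩
    exact ⟨u 0, hu⟩

/-- The index need not be an element of the structure: the formula is a finite disjunction, and each
index may enter through its own parameters. -/
theorem DefPred.exFinite {ι : Type*} {s : Set ι} (hs : s.Finite) {P : (α → M) → ι → Prop}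
    (h : ∀ i, DefPred L fun x => P x i) : DefPred L fun x => ∃ i ∈ s, P x i := by
  refine DefPred.congr (P := fun x => x ∈ ⋃ i ∈ hs.toFinset, {x | P x i})
    (Set.definable_biUnion_finset h hs.toFinset) fun x => ?_
  simp

theorem DefPred.eq {f g : (α → M) → M} (hf : DefTerm L f) (hg : DefTerm L g) :
    DefPred L fun x => f x = g x := by
  obtain ⟨φ, hφ⟩ := hf
  obtain ⟨ψ, hψ⟩ := hg
  refine ⟨φ.equal ψ, ?_⟩
  ext x
  rw [Set.mem_ofPred_eq, Set.mem_ofPred_eq, Language.Formula.realize_equal, hφ, hψ]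

theorem DefPred.subst {P : (α → M) → Prop} (hP : DefPred L P) {t : (β → M) → α → M}
    (ht : ∀ a, DefTerm L fun x => t x a) : DefPred L fun x => P (t x) := by
  obtain ⟨φ, hφ⟩ := hP
  choose ψ hψ using ht
  refine ⟨Language.BoundedFormula.subst φ ψ, ?_⟩
  ext x
  have h1 : (t x ∈ {x | P x}) ↔ φ.Realize (t x) := by rw [hφ]; rfl
  have h2 : t x = fun a => (ψ a).realize x := funext fun a => hψ a x
  rw [Set.mem_ofPred_eq, Set.mem_ofPred_eq, Language.Formula.Realize,
    Language.BoundedFormula.realize_subst, ← h2]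
  exact h1

end Definability

attribute [local instance] groupStructure

section GroupTerms

variable {G : Type*} [Group G] {α : Type*} {f g : (α → G) → G}

theorem DefTerm.mul (hf : DefTerm groupLang f) (hg : DefTerm groupLang g) :
    DefTerm groupLang fun x => f x * g x :=
  DefTerm.fun₂ (L := groupLang) GroupFunc.mul hf hg

theorem DefTerm.inv (hf : DefTerm groupLang f) : DefTerm groupLang fun x => (f x)⁻¹ :=
  DefTerm.fun₁ (L := groupLang) GroupFunc.inv hf

theorem DefTerm.pow (hf : DefTerm groupLang f) (n : ℕ) : DefTerm groupLang fun x => f x ^ n := by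
  induction n with
  | zero => simpa only [pow_zero] using DefTerm.const 1
  | succ n ih => simpa only [pow_succ] using ih.mul hf

end GroupTerms

attribute [local instance] Ring.compatibleRingOfRing

section RingTerms

variable {R : Type*} [CommRing R] {α : Type*} {f g : (α → R) → R}

theorem DefTerm.add (hf : DefTerm FirstOrder.Language.ring f) (hg : DefTerm FirstOrder.Language.ring g) :
    DefTerm FirstOrder.Language.ring fun x => f x + g x := by
  simpa using DefTerm.fun₂ Ring.addFunc hf hg

theorem DefTerm.rmul (hf : DefTerm FirstOrder.Language.ring f) (hg : DefTerm FirstOrder.Language.ring g) :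
    DefTerm FirstOrder.Language.ring fun x => f x * g x := by
  simpa using DefTerm.fun₂ Ring.mulFunc hf hg

theorem DefTerm.neg (hf : DefTerm FirstOrder.Language.ring f) :
    DefTerm FirstOrder.Language.ring fun x => - f x := by
  simpa using DefTerm.fun₁ Ring.negFunc hf

theorem DefTerm.sub (hf : DefTerm FirstOrder.Language.ring f) (hg : DefTerm FirstOrder.Language.ring g) :
    DefTerm FirstOrder.Language.ring fun x => f x - g x := by
  simpa only [sub_eq_add_neg] using hf.add hg.neg

end RingTerms

/-! ### Matrices in `SL₂` modulo scalars -/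

section SL2

variable {R : Type*} [CommRing R]

/-- The element of `SL₂(R)` with given entries. -/
def slMat (a b c d : R) (h : a * d - b * c = 1) : SL(2, R) :=
  ⟨!![a, b; c, d], by rw [Matrix.det_fin_two_of, h]⟩

/-- The upper unitriangular matrix with upper right entry `t`. -/
def upper (t : R) : SL(2, R) := slMat 1 t 0 1 (by ring)

/-- The lower unitriangular matrix with lower left entry `t`. -/
def lower (t : R) : SL(2, R) := slMat 1 0 t 1 (by ring)

/-- The Weyl element. -/
def weyl : SL(2, R) := slMat 0 1 (-1) 0 (by ring)

section Entries

variable (a b c d : R) (h : a * d - b * c = 1) (A B : SL(2, R))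

@[simp] theorem slMat_zero_zero : slMat a b c d h 0 0 = a := rfl
@[simp] theorem slMat_zero_one : slMat a b c d h 0 1 = b := rfl
@[simp] theorem slMat_one_zero : slMat a b c d h 1 0 = c := rfl
@[simp] theorem slMat_one_one : slMat a b c d h 1 1 = d := rfl
@[simp] theorem upper_zero_zero : upper a 0 0 = 1 := rfl
@[simp] theorem upper_zero_one : upper a 0 1 = a := rfl
@[simp] theorem upper_one_zero : upper a 1 0 = 0 := rfl
@[simp] theorem upper_one_one : upper a 1 1 = 1 := rfl
@[simp] theorem lower_zero_zero : lower a 0 0 = 1 := rfl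
@[simp] theorem lower_zero_one : lower a 0 1 = 0 := rfl
@[simp] theorem lower_one_zero : lower a 1 0 = a := rfl
@[simp] theorem lower_one_one : lower a 1 1 = 1 := rfl
@[simp] theorem weyl_zero_zero : (weyl : SL(2, R)) 0 0 = 0 := rfl
@[simp] theorem weyl_zero_one : (weyl : SL(2, R)) 0 1 = 1 := rfl
@[simp] theorem weyl_one_zero : (weyl : SL(2, R)) 1 0 = -1 := rfl
@[simp] theorem weyl_one_one : (weyl : SL(2, R)) 1 1 = 0 := rfl

theorem sl_mul_apply (i j : Fin 2) : (A * B) i j = A i 0 * B 0 j + A i 1 * B 1 j := by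
  rw [Matrix.SpecialLinearGroup.coe_mul, Matrix.mul_apply, Fin.sum_univ_two]

theorem sl_det : A 0 0 * A 1 1 - A 0 1 * A 1 0 = 1 := by
  rw [← Matrix.det_fin_two, A.det_coe]

@[simp] theorem sl_inv_zero_zero : A⁻¹ 0 0 = A 1 1 := by
  rw [Matrix.SpecialLinearGroup.SL2_inv_expl]; rfl
@[simp] theorem sl_inv_zero_one : A⁻¹ 0 1 = -A 0 1 := by
  rw [Matrix.SpecialLinearGroup.SL2_inv_expl]; rfl
@[simp] theorem sl_inv_one_zero : A⁻¹ 1 0 = -A 1 0 := by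
  rw [Matrix.SpecialLinearGroup.SL2_inv_expl]; rfl
@[simp] theorem sl_inv_one_one : A⁻¹ 1 1 = A 0 0 := by
  rw [Matrix.SpecialLinearGroup.SL2_inv_expl]; rfl

variable {A B}

theorem sl_ext (h00 : A 0 0 = B 0 0) (h01 : A 0 1 = B 0 1) (h10 : A 1 0 = B 1 0)
    (h11 : A 1 1 = B 1 1) : A = B := by
  ext i j
  fin_cases i <;> fin_cases j <;> assumption

end Entries

theorem upper_mul_upper (s t : R) : upper s * upper t = upper (s + t) := by
  apply sl_ext <;> simp [sl_mul_apply, add_comm]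

theorem weyl_mul_upper_mul_weyl_inv (t : R) : weyl * upper (-t) * weyl⁻¹ = lower t := by
  apply sl_ext <;> simp [sl_mul_apply]

/-- Subtracting `e` times the first row leaves the unit `u` in the lower left corner. Dividing by
`u` then yields `x` and `z`, and the determinant condition gives the last equations. -/
theorem lower_upper_factorization (A : SL(2, R)) (e : R) (u : Rˣ) (h : A 1 0 = e * A 0 0 + u) :
    ∃ x z, A 0 0 = 1 + x * u ∧ A 0 1 = A 0 0 * z + x ∧ A 1 1 = A 1 0 * z + 1 + e * x := by
  have hd := sl_det A
  have hu : (u : R) * ((u⁻¹ : Rˣ) : R) = 1 := u.mul_inv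
  generalize ((u⁻¹ : Rˣ) : R) = w at hu
  have hb : A 0 1 = A 0 0 * ((A 1 1 - e * A 0 1 - 1) * w) + (A 0 0 - 1) * w := by
    linear_combination (-w) * hd - w * A 0 1 * h - A 0 1 * hu
  refine ⟨(A 0 0 - 1) * w, (A 1 1 - e * A 0 1 - 1) * w, ?_, hb, ?_⟩
  · linear_combination (1 - A 0 0) * hu
  · linear_combination -((A 1 1 - e * A 0 1 - 1) * w) * h - (A 1 1 - e * A 0 1 - 1) * hu + e * hb

/-- No invertibility of `y` is needed here, so a formula built on these equations need not express
that `y` is a unit. -/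
theorem eq_lower_upper_product (A : SL(2, R)) {e x y z : R} (h00 : A 0 0 = 1 + x * y)
    (h01 : A 0 1 = A 0 0 * z + x) (h10 : A 1 0 = e * A 0 0 + y)
    (h11 : A 1 1 = A 1 0 * z + 1 + e * x) : A = lower e * upper x * lower y * upper z := by
  apply sl_ext <;> simp only [sl_mul_apply, upper_zero_zero, upper_zero_one, upper_one_zero,
    upper_one_one, lower_zero_zero, lower_zero_one, lower_one_zero, lower_one_one]
  · linear_combination h00
  · linear_combination h01 + z * h00
  · linear_combination h10 + e * h00
  · linear_combination h11 + z * h10 + e * z * h00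

/-! ### Centralisers and torus action in quotients by scalars -/

variable {G : Type*} [Group G]

/-- The homomorphism `π` out of `SL₂(R)` identifies matrices only up to scalars. -/
def ScalarKernel (π : SL(2, R) →* G) : Prop :=
  ∀ A, π A = 1 → A 0 1 = 0 ∧ A 1 0 = 0 ∧ A 0 0 = A 1 1

variable {π : SL(2, R) →* G}

theorem ScalarKernel.exists_scalar (hπ : ScalarKernel π) {A B : SL(2, R)} (h : π A = π B) :
    ∃ z : R, z * z = 1 ∧ ∀ i j, A i j = z * B i j := by
  have h1 : π (A * B⁻¹) = 1 := by rw [map_mul, map_inv, h, mul_inv_cancel]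
  obtain ⟨h2, h3, h4⟩ := hπ _ h1
  have h5 := sl_det (A * B⁻¹)
  refine ⟨(A * B⁻¹) 0 0, by rw [h2, ← h4] at h5; simpa using h5, fun i j => ?_⟩
  have h6 : A i j = (A * B⁻¹ * B) i j := by rw [inv_mul_cancel_right]
  rw [h6, sl_mul_apply]
  fin_cases i
  · change _ + (A * B⁻¹) 0 1 * _ = _
    rw [h2]; simp
  · change (A * B⁻¹) 1 0 * _ + (A * B⁻¹) 1 1 * _ = _
    rw [h3, ← h4]; simp

/-- Commuting in `G` only means commuting up to a scalar `z`. Reducedness forces the lower left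
entry to vanish, and then `z = 1`, so the matrices commute in `SL₂(R)` itself. -/
theorem ScalarKernel.commute_upper_iff (hR : ∀ c : R, c * c = 0 → c = 0) (hπ : ScalarKernel π)
    {A : SL(2, R)} : Commute (π A) (π (upper 1)) ↔ A 1 0 = 0 ∧ A 0 0 = A 1 1 := by
  constructor
  · intro h
    have h1 : π (A * upper 1) = π (upper 1 * A) := by rw [map_mul, map_mul]; exact h
    obtain ⟨z, hz, h2⟩ := hπ.exists_scalar h1
    have h00 := h2 0 0
    have h01 := h2 0 1
    have h10 := h2 1 0
    have h11 := h2 1 1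
    have hd := sl_det A
    simp only [sl_mul_apply, upper_zero_zero, upper_zero_one, upper_one_zero, upper_one_one]
      at h00 h01 h10 h11
    -- With lower row `(c, d)` the equations read `c = z * c` and `c + d = z * d`; eliminating `z`
    -- leaves `c * c = 0`.
    have hc : A 1 0 = 0 := hR _ (by linear_combination A 1 0 * h11 - A 1 1 * h10)
    rw [hc] at h00 hd
    have hz1 : z = 1 := by linear_combination (1 - z) * hd - A 1 1 * h00
    refine ⟨hc, ?_⟩
    rw [hz1] at h01
    linear_combination h01
  · rintro ⟨h1, h2⟩
    refine (Commute.map (?_ : Commute A (upper 1)) π)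
    apply sl_ext <;> simp [sl_mul_apply, h1, h2, add_comm]

theorem ScalarKernel.commute_lower_iff (hR : ∀ c : R, c * c = 0 → c = 0) (hπ : ScalarKernel π)
    {A : SL(2, R)} : Commute (π A) (π (lower 1)) ↔ A 0 1 = 0 ∧ A 0 0 = A 1 1 := by
  constructor
  · intro h
    have h1 : π (A * lower 1) = π (lower 1 * A) := by rw [map_mul, map_mul]; exact h
    obtain ⟨z, hz, h2⟩ := hπ.exists_scalar h1
    have h00 := h2 0 0
    have h01 := h2 0 1
    have h10 := h2 1 0
    have h11 := h2 1 1
    have hd := sl_det A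
    simp only [sl_mul_apply, lower_zero_zero, lower_zero_one, lower_one_zero, lower_one_one]
      at h00 h01 h10 h11
    have hc : A 0 1 = 0 := hR _ (by linear_combination A 0 1 * h00 - A 0 0 * h01)
    rw [hc] at h00 hd
    have hz1 : z = 1 := by linear_combination (1 - z) * hd - A 1 1 * h00
    refine ⟨hc, ?_⟩
    rw [hz1] at h10
    linear_combination -h10
  · rintro ⟨h1, h2⟩
    refine (Commute.map (?_ : Commute A (lower 1)) π)
    apply sl_ext <;> simp [sl_mul_apply, h1, h2, add_comm]

/-- The element `g` of `G` represents `t`: it is, up to scalars, the image of `upper t`. -/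
def Represents (π : SL(2, R) →* G) (g : G) (t : R) : Prop :=
  ∃ A, π A = g ∧ A 1 0 = 0 ∧ A 0 0 = A 1 1 ∧ A 0 0 * A 0 1 = t

theorem represents_upper (t : R) : Represents π (π (upper t)) t :=
  ⟨upper t, rfl, by simp, by simp, by simp⟩

theorem Represents.mul {g g' : G} {s t : R} (hg : Represents π g s) (hg' : Represents π g' t) :
    Represents π (g * g') (s + t) := by
  obtain ⟨A, rfl, h1, h2, rfl⟩ := hg
  obtain ⟨B, rfl, h3, h4, rfl⟩ := hg'
  have hA := sl_det A
  have hB := sl_det B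
  rw [h1, ← h2] at hA
  rw [h3, ← h4] at hB
  refine ⟨A * B, map_mul _ _ _, ?_, ?_, ?_⟩ <;>
    simp only [sl_mul_apply, h1, h3, ← h2, ← h4]
  · ring
  · ring
  · linear_combination (B 0 0 * B 0 1) * hA + (A 0 0 * A 0 1) * hB

theorem Represents.inv {g : G} {t : R} (hg : Represents π g t) : Represents π g⁻¹ (-t) := by
  obtain ⟨A, rfl, h1, h2, rfl⟩ := hg
  exact ⟨A⁻¹, map_inv _ _, by simp [h1], by simp [h2], by simp [h2]⟩

theorem Represents.pow {g : G} {t : R} (hg : Represents π g t) (n : ℕ) :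
    Represents π (g ^ n) (n * t) := by
  induction n with
  | zero => simpa using ⟨1, map_one π, by simp, by simp, by simp⟩
  | succ n ih =>
    rw [pow_succ]
    convert! ih.mul hg using 1
    push_cast
    ring

/-- Replacing a matrix by a scalar multiple multiplies `A 0 0 * A 0 1` by `z * z = 1`, which is why
this product, and not `A 0 1`, is taken as the value. -/
theorem ScalarKernel.represents_unique (hπ : ScalarKernel π) {g : G} {s t : R}
    (hs : Represents π g s) (ht : Represents π g t) : s = t := by
  obtain ⟨A, hA, -, -, rfl⟩ := hs
  obtain ⟨B, rfl, -, -, rfl⟩ := ht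
  obtain ⟨z, hz, h⟩ := hπ.exists_scalar hA
  rw [h, h]
  linear_combination (B 0 0 * B 0 1) * hz

theorem ScalarKernel.commute_upper_iff_represents (hR : ∀ c : R, c * c = 0 → c = 0)
    (hπ : ScalarKernel π) (hs : Function.Surjective π) {g : G} :
    Commute g (π (upper 1)) ↔ ∃ t, Represents π g t := by
  obtain ⟨A, rfl⟩ := hs g
  constructor
  · intro h
    rw [hπ.commute_upper_iff hR] at h
    exact ⟨_, A, rfl, h.1, h.2, rfl⟩
  · rintro ⟨t, B, hB, h1, h2, -⟩
    rw [← hB, hπ.commute_upper_iff hR]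
    exact ⟨h1, h2⟩

/-- The quotient represents `s - t`. Being already upper triangular with equal diagonal entries, it
commutes with `π (lower 1)` exactly when it is scalar. -/
theorem ScalarKernel.commute_lower_iff_eq (hR : ∀ c : R, c * c = 0 → c = 0)
    (hπ : ScalarKernel π) {g g' : G} {s t : R} (hg : Represents π g s)
    (hg' : Represents π g' t) : Commute (g * g'⁻¹) (π (lower 1)) ↔ s = t := by
  obtain ⟨A, h1, h2, h3, h4⟩ := hg.mul hg'.inv
  rw [← h1, hπ.commute_lower_iff hR, ← sub_eq_zero (a := s), sub_eq_add_neg, ← h4]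
  constructor
  · rintro ⟨h, -⟩
    rw [h, mul_zero]
  · intro h
    have hd := sl_det A
    rw [h2, ← h3] at hd
    exact ⟨by linear_combination (-A 0 1) * hd + A 0 0 * h, h3⟩

/-- The elements of `G` which normalise the images of both unipotent groups. -/
def IsTorus (π : SL(2, R) →* G) (h : G) : Prop :=
  Commute (h * π (upper 1) * h⁻¹) (π (upper 1)) ∧ Commute (h * π (lower 1) * h⁻¹) (π (lower 1))

/-- The two conjugates have corner entries `-(A 1 0) ^ 2` and `-(A 0 1) ^ 2`, so reducedness makes
`A` diagonal. -/
theorem ScalarKernel.isTorus_iff (hR : ∀ c : R, c * c = 0 → c = 0) (hπ : ScalarKernel π)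
    {A : SL(2, R)} : IsTorus π (π A) ↔ A 0 1 = 0 ∧ A 1 0 = 0 := by
  have hd := sl_det A
  rw [IsTorus, ← map_inv, ← map_mul, ← map_mul, ← map_mul, ← map_mul, hπ.commute_upper_iff hR,
    hπ.commute_lower_iff hR]
  simp only [sl_mul_apply, upper_zero_zero, upper_zero_one, upper_one_zero, upper_one_one,
    lower_zero_zero, lower_zero_one, lower_one_zero, lower_one_one, sl_inv_zero_zero,
    sl_inv_zero_one, sl_inv_one_zero, sl_inv_one_one]
  constructor
  · rintro ⟨⟨h1, -⟩, ⟨h2, -⟩⟩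
    exact ⟨hR _ (by linear_combination -h2), hR _ (by linear_combination -h1)⟩
  · rintro ⟨h1, h2⟩
    simp [h1, h2, mul_comm]

theorem ScalarKernel.represents_conj (hR : ∀ c : R, c * c = 0 → c = 0) (hπ : ScalarKernel π)
    (hs : Function.Surjective π) {h : G} (hh : IsTorus π h) :
    ∃ r : Rˣ, ∀ g t, Represents π g t → Represents π (h * g * h⁻¹) ((r : R) ^ 2 * t) := by
  obtain ⟨A, rfl⟩ := hs h
  rw [hπ.isTorus_iff hR] at hh
  have hd := sl_det A
  obtain ⟨h1, h2⟩ := hh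
  rw [h1, zero_mul, sub_zero] at hd
  refine ⟨⟨A 0 0, A 1 1, hd, by rw [mul_comm, hd]⟩, ?_⟩
  rintro g t ⟨B, rfl, h3, h4, rfl⟩
  refine ⟨A * B * A⁻¹, by simp, ?_, ?_, ?_⟩ <;>
    simp only [sl_mul_apply, h1, h2, h3, ← h4, sl_inv_zero_zero,
      sl_inv_zero_one, sl_inv_one_zero, sl_inv_one_one]
  · ring
  · ring
  · linear_combination (A 0 0 * A 0 0 * B 0 0 * B 0 1) * hd

/-- Together with `ScalarKernel.represents_conj`, this identifies the action of the definable torus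
on values with multiplication by squares of units. -/
theorem ScalarKernel.exists_isTorus (hR : ∀ c : R, c * c = 0 → c = 0) (hπ : ScalarKernel π)
    (r : Rˣ) : ∃ h : G, IsTorus π h ∧
      ∀ g t, Represents π g t → Represents π (h * g * h⁻¹) ((r : R) ^ 2 * t) := by
  have hr : (r : R) * ((r⁻¹ : Rˣ) : R) = 1 := r.mul_inv
  refine ⟨π (slMat (r : R) 0 0 ((r⁻¹ : Rˣ) : R) (by simp)), ?_, ?_⟩
  · rw [hπ.isTorus_iff hR]
    simp
  rintro g t ⟨B, rfl, h3, h4, rfl⟩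
  refine ⟨slMat (r : R) 0 0 ((r⁻¹ : Rˣ) : R) (by simp) * B *
    (slMat (r : R) 0 0 ((r⁻¹ : Rˣ) : R) (by simp))⁻¹, by simp, ?_, ?_, ?_⟩ <;>
    simp only [sl_mul_apply, h3, ← h4, sl_inv_zero_zero, slMat_zero_zero, slMat_zero_one,
      slMat_one_zero, slMat_one_one, sl_inv_zero_one, sl_inv_one_zero, sl_inv_one_one]
  · ring
  · ring
  · linear_combination ((r : R) * r * B 0 0 * B 0 1) * hr

/-- Squaring turns the unknown scalar `z` into `z * z = 1`, so the result is an exact unitriangular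
image, at the cost of doubling `t`. -/
theorem Represents.upper_mul_sq {y : G} {t : R} (hy : Represents π y t) (c : R) :
    π (upper c) * (y * y) = π (upper (c + 2 * t)) := by
  obtain ⟨A, rfl, h1, h2, rfl⟩ := hy
  have hd := sl_det A
  rw [h1, ← h2, mul_zero, sub_zero] at hd
  rw [← map_mul, ← map_mul]
  congr 1
  apply sl_ext <;> simp only [sl_mul_apply, h1, ← h2, upper_zero_zero, upper_zero_one,
    upper_one_zero, upper_one_one]
  · linear_combination hd
  · linear_combination c * hd
  · ring
  · linear_combination hd

end SL2

/-! ### The bi-interpretation -/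

/-- The properties of a commutative ring which make it bi-interpretable with the quotients of
`SL₂` by groups of scalars. -/
structure UnitSquareRing (R : Type*) [CommRing R] : Prop where
  eq_zero_of_mul_self : ∀ c : R, c * c = 0 → c = 0
  eq_zero_of_mul : ∀ a : R, 24 * a = 0 → a = 0
  exists_unit_squares : ∀ t : R, ∃ r₁ r₂ r₃ r₄ : Rˣ,
    24 * t = (r₁ : R) ^ 2 - (r₂ : R) ^ 2 + (r₃ : R) ^ 2 - (r₄ : R) ^ 2
  -- Squares in the centraliser reach only the images of `upper (2 * b)`; elements of `S` become
  -- parameters for the other cosets.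
  exists_finite : ∃ S : Set R, S.Finite ∧ ∀ a, ∃ c ∈ S, ∃ b, a = c + 2 * b
  -- This supplies the unit required by `lower_upper_factorization`.
  exists_isUnit : ∀ a b c d : R, a * d - b * c = 1 → ∃ e, IsUnit (c - e * a)

section GroupPredicates

variable {R : Type*} [CommRing R] {G : Type*} [Group G] (π : SL(2, R) →* G)

/-- Two representatives represent the same element of `R`. -/
def SameValue (g g' : G) : Prop := Commute (g * g'⁻¹) (π (lower 1))

/-- An alternating product of conjugates. -/
def conjProd (h₁ h₂ h₃ h₄ g : G) : G :=
  h₁ * g * h₁⁻¹ * (h₂ * g * h₂⁻¹)⁻¹ * (h₃ * g * h₃⁻¹) * (h₄ * g * h₄⁻¹)⁻¹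

/-- The value of `z` is the product of those of `x` and `y`, and this is witnessed by writing
the value of `y` as an alternating sum of four squares of units. -/
def IsSquareProduct (x y z : G) : Prop :=
  ∃ h₁ h₂ h₃ h₄ : G, (IsTorus π h₁ ∧ IsTorus π h₂ ∧ IsTorus π h₃ ∧ IsTorus π h₄) ∧
    SameValue π y (conjProd h₁ h₂ h₃ h₄ (π (upper 1))) ∧ SameValue π z (conjProd h₁ h₂ h₃ h₄ x)

/-- The value of `z` is the product of those of `x` and `y`. -/
def IsProduct (x y z : G) : Prop := IsSquareProduct π x (y ^ 24) (z ^ 24)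

/-- The element `g` is the image of an upper unitriangular matrix. -/
def IsUpper (S : Set R) (g : G) : Prop :=
  ∃ c ∈ S, ∃ y, Commute y (π (upper 1)) ∧ g = π (upper c) * (y * y)

/-- The image of a lower unitriangular matrix, computed from that of an upper one. -/
def toLower (g : G) : G := π weyl * g⁻¹ * (π weyl)⁻¹

/-- The element `g` is the image of the matrix whose entries are the values of `A`, `B`, `C`,
`D`. -/
def IsImage (S : Set R) (A B C D g : G) : Prop :=
  ∃ e x y z p q r s t : G, (IsUpper π S e ∧ IsUpper π S x ∧ IsUpper π S y ∧ IsUpper π S z) ∧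
    (Commute p (π (upper 1)) ∧ Commute q (π (upper 1)) ∧ Commute r (π (upper 1)) ∧
      Commute s (π (upper 1)) ∧ Commute t (π (upper 1))) ∧
    (IsProduct π x y p ∧ IsProduct π A z q ∧ IsProduct π e A r ∧ IsProduct π C z s ∧
      IsProduct π e x t) ∧
    (SameValue π A (π (upper 1) * p) ∧ SameValue π B (q * x) ∧ SameValue π C (r * y) ∧
      SameValue π D (s * π (upper 1) * t)) ∧
    g = toLower π e * x * toLower π y * z

/-- The element of `R` represented by `g`. -/
noncomputable def value (g : G) : R :=
  open Classical in if h : ∃ t, Represents π g t then h.choose else 0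

section Definability

variable {π} {α : Type*}

theorem defPred_commute {f g : (α → G) → G} (hf : DefTerm groupLang f)
    (hg : DefTerm groupLang g) : DefPred groupLang fun x => Commute (f x) (g x) :=
  DefPred.eq (hf.mul hg) (hg.mul hf)

theorem defPred_sameValue {f g : (α → G) → G} (hf : DefTerm groupLang f)
    (hg : DefTerm groupLang g) : DefPred groupLang fun x => SameValue π (f x) (g x) :=
  defPred_commute (hf.mul hg.inv) (.const _)

theorem defPred_isTorus {f : (α → G) → G} (hf : DefTerm groupLang f) :
    DefPred groupLang fun x => IsTorus π (f x) :=
  (defPred_commute ((hf.mul (.const _)).mul hf.inv) (.const _)).and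
    (defPred_commute ((hf.mul (.const _)).mul hf.inv) (.const _))

theorem defTerm_conjProd {h₁ h₂ h₃ h₄ g : (α → G) → G} (hh₁ : DefTerm groupLang h₁)
    (hh₂ : DefTerm groupLang h₂) (hh₃ : DefTerm groupLang h₃) (hh₄ : DefTerm groupLang h₄)
    (hg : DefTerm groupLang g) :
    DefTerm groupLang fun x => conjProd (h₁ x) (h₂ x) (h₃ x) (h₄ x) (g x) :=
  ((((hh₁.mul hg).mul hh₁.inv).mul ((hh₂.mul hg).mul hh₂.inv).inv).mul
    ((hh₃.mul hg).mul hh₃.inv)).mul ((hh₄.mul hg).mul hh₄.inv).inv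

theorem defPred_isSquareProduct {f g h : (α → G) → G} (hf : DefTerm groupLang f)
    (hg : DefTerm groupLang g) (hh : DefTerm groupLang h) :
    DefPred groupLang fun x => IsSquareProduct π (f x) (g x) (h x) := by
  unfold IsSquareProduct
  refine DefPred.ex (DefPred.ex (DefPred.ex (DefPred.ex ?_)))
  refine .and (.and ?_ (.and ?_ (.and ?_ ?_))) (.and ?_ ?_)
  · exact defPred_isTorus (.var _)
  · exact defPred_isTorus (.var _)
  · exact defPred_isTorus (.var _)
  · exact defPred_isTorus (.var _)
  · exact defPred_sameValue hg.lift.lift.lift.lift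
      (defTerm_conjProd (.var _) (.var _) (.var _) (.var _) (.const _))
  · exact defPred_sameValue hh.lift.lift.lift.lift
      (defTerm_conjProd (.var _) (.var _) (.var _) (.var _) hf.lift.lift.lift.lift)

theorem defPred_isProduct {f g h : (α → G) → G} (hf : DefTerm groupLang f)
    (hg : DefTerm groupLang g) (hh : DefTerm groupLang h) :
    DefPred groupLang fun x => IsProduct π (f x) (g x) (h x) :=
  defPred_isSquareProduct hf (hg.pow 24) (hh.pow 24)

theorem defPred_isUpper {S : Set R} (hS : S.Finite) {f : (α → G) → G}
    (hf : DefTerm groupLang f) : DefPred groupLang fun x => IsUpper π S (f x) := by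
  refine DefPred.exFinite hS fun c => DefPred.ex (.and ?_ ?_)
  · exact defPred_commute (.var _) (.const _)
  · exact .eq hf.lift ((DefTerm.const _).mul (.mul (.var _) (.var _)))

theorem defTerm_toLower {f : (α → G) → G} (hf : DefTerm groupLang f) :
    DefTerm groupLang fun x => toLower π (f x) :=
  ((DefTerm.const _).mul hf.inv).mul (.const _)

theorem defPred_isImage {S : Set R} (hS : S.Finite) :
    DefPred groupLang fun x : Fin 5 → G => IsImage π S (x 0) (x 1) (x 2) (x 3) (x 4) := by
  unfold IsImage
  iterate 9 refine DefPred.ex ?_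
  refine .and (.and ?_ (.and ?_ (.and ?_ ?_))) (.and (.and ?_ (.and ?_ (.and ?_ (.and ?_ ?_))))
    (.and (.and ?_ (.and ?_ (.and ?_ (.and ?_ ?_)))) (.and (.and ?_ (.and ?_ (.and ?_ ?_))) ?_)))
  iterate 4 exact defPred_isUpper hS (.var _)
  iterate 5 exact defPred_commute (.var _) (.const _)
  iterate 5 exact defPred_isProduct (.var _) (.var _) (.var _)
  · exact defPred_sameValue (.var _) (.mul (.const _) (.var _))
  · exact defPred_sameValue (.var _) (.mul (.var _) (.var _))
  · exact defPred_sameValue (.var _) (.mul (.var _) (.var _))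
  · exact defPred_sameValue (.var _) (.mul (.mul (.var _) (.const _)) (.var _))
  · exact .eq (.var _) (.mul (.mul (.mul (defTerm_toLower (.var _)) (.var _))
      (defTerm_toLower (.var _))) (.var _))

end Definability

/-! ### Correctness of the group formulas -/

section Semantics

variable {π}

theorem ScalarKernel.value_eq (hπ : ScalarKernel π) {g : G} {t : R} (h : Represents π g t) :
    value π g = t := by
  have h' : ∃ t, Represents π g t := ⟨t, h⟩
  rw [value, dif_pos h']
  exact hπ.represents_unique h'.choose_spec h

theorem UnitSquareRing.represents_value (hR : UnitSquareRing R) (hπ : ScalarKernel π)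
    (hs : Function.Surjective π) {g : G} (hg : Commute g (π (upper 1))) :
    Represents π g (value π g) := by
  obtain ⟨t, ht⟩ := (hπ.commute_upper_iff_represents hR.eq_zero_of_mul_self hs).1 hg
  rwa [hπ.value_eq ht]

theorem UnitSquareRing.sameValue_iff (hR : UnitSquareRing R) (hπ : ScalarKernel π) {g g' : G}
    {s t : R} (hg : Represents π g s) (hg' : Represents π g' t) : SameValue π g g' ↔ s = t :=
  hπ.commute_lower_iff_eq hR.eq_zero_of_mul_self hg hg'

/-- An alternating product of torus conjugates multiplies every value by one common factor. Its
effect on `1` fixes that factor as `24 * s`, so its effect on `r` is determined whichever torus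
elements are used. -/
theorem UnitSquareRing.isProduct_iff (hR : UnitSquareRing R) (hπ : ScalarKernel π)
    (hs : Function.Surjective π) {x y z : G} {r s t : R} (hx : Represents π x r)
    (hy : Represents π y s) (hz : Represents π z t) : IsProduct π x y z ↔ r * s = t := by
  have hy' := hy.pow 24
  have hz' := hz.pow 24
  push_cast at hy' hz'
  have key : ∀ {h₁ h₂ h₃ h₄ : G} {r₁ r₂ r₃ r₄ : Rˣ},
      (∀ g t, Represents π g t → Represents π (h₁ * g * h₁⁻¹) ((r₁ : R) ^ 2 * t)) →
      (∀ g t, Represents π g t → Represents π (h₂ * g * h₂⁻¹) ((r₂ : R) ^ 2 * t)) →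
      (∀ g t, Represents π g t → Represents π (h₃ * g * h₃⁻¹) ((r₃ : R) ^ 2 * t)) →
      (∀ g t, Represents π g t → Represents π (h₄ * g * h₄⁻¹) ((r₄ : R) ^ 2 * t)) →
      ∀ g t, Represents π g t → Represents π (conjProd h₁ h₂ h₃ h₄ g)
        (((r₁ : R) ^ 2 - (r₂ : R) ^ 2 + (r₃ : R) ^ 2 - (r₄ : R) ^ 2) * t) := by
    intro h₁ h₂ h₃ h₄ r₁ r₂ r₃ r₄ k₁ k₂ k₃ k₄ g t hg
    have := (((k₁ g t hg).mul (k₂ g t hg).inv).mul (k₃ g t hg)).mul (k₄ g t hg).inv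
    convert! this using 1
    ring
  constructor
  · rintro ⟨h₁, h₂, h₃, h₄, ⟨H₁, H₂, H₃, H₄⟩, e₁, e₂⟩
    obtain ⟨r₁, k₁⟩ := hπ.represents_conj hR.eq_zero_of_mul_self hs H₁
    obtain ⟨r₂, k₂⟩ := hπ.represents_conj hR.eq_zero_of_mul_self hs H₂
    obtain ⟨r₃, k₃⟩ := hπ.represents_conj hR.eq_zero_of_mul_self hs H₃
    obtain ⟨r₄, k₄⟩ := hπ.represents_conj hR.eq_zero_of_mul_self hs H₄
    rw [hR.sameValue_iff hπ hy' (key k₁ k₂ k₃ k₄ _ _ (represents_upper 1))] at e₁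
    rw [hR.sameValue_iff hπ hz' (key k₁ k₂ k₃ k₄ _ _ hx)] at e₂
    -- Comparing the two equations gives `24 * (r * s - t) = 0`.
    exact sub_eq_zero.1 (hR.eq_zero_of_mul _ (by linear_combination r * e₁ - e₂))
  · rintro rfl
    obtain ⟨r₁, r₂, r₃, r₄, hr⟩ := hR.exists_unit_squares s
    obtain ⟨h₁, H₁, k₁⟩ := hπ.exists_isTorus hR.eq_zero_of_mul_self r₁
    obtain ⟨h₂, H₂, k₂⟩ := hπ.exists_isTorus hR.eq_zero_of_mul_self r₂
    obtain ⟨h₃, H₃, k₃⟩ := hπ.exists_isTorus hR.eq_zero_of_mul_self r₃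
    obtain ⟨h₄, H₄, k₄⟩ := hπ.exists_isTorus hR.eq_zero_of_mul_self r₄
    refine ⟨h₁, h₂, h₃, h₄, ⟨H₁, H₂, H₃, H₄⟩, ?_, ?_⟩
    · rw [hR.sameValue_iff hπ hy' (key k₁ k₂ k₃ k₄ _ _ (represents_upper 1))]
      linear_combination hr
    · rw [hR.sameValue_iff hπ hz' (key k₁ k₂ k₃ k₄ _ _ hx)]
      linear_combination r * hr

theorem UnitSquareRing.isUpper_iff (hR : UnitSquareRing R) (hπ : ScalarKernel π)
    (hs : Function.Surjective π) {S : Set R} (hS : ∀ a, ∃ c ∈ S, ∃ b, a = c + 2 * b) {g : G} :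
    IsUpper π S g ↔ ∃ t, g = π (upper t) := by
  constructor
  · rintro ⟨c, -, y, hy, rfl⟩
    exact ⟨_, (hR.represents_value hπ hs hy).upper_mul_sq c⟩
  · rintro ⟨t, rfl⟩
    obtain ⟨c, hc, b, rfl⟩ := hS t
    refine ⟨c, hc, π (upper b), ?_, ((represents_upper b).upper_mul_sq c).symm⟩
    exact (hπ.commute_upper_iff_represents hR.eq_zero_of_mul_self hs).2 ⟨b, represents_upper b⟩

theorem toLower_upper (t : R) : toLower π (π (upper t)) = π (lower t) := by
  have h : (upper t)⁻¹ = upper (-t) := inv_eq_of_mul_eq_one_right (by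
    rw [upper_mul_upper, add_neg_cancel]
    apply sl_ext <;> simp)
  rw [toLower, ← map_inv, h, ← map_mul, ← map_inv, ← map_mul, weyl_mul_upper_mul_weyl_inv]

/-- The arguments `A`, `B`, `C`, `D` fix their values only up to scalars on the group side, whereas
`g` must be exact. Hence the factors of `g` are exact unitriangular images, while the auxiliary
products `p` to `t` need only represent the right values. -/
theorem UnitSquareRing.isImage_iff (hR : UnitSquareRing R) (hπ : ScalarKernel π)
    (hs : Function.Surjective π) {S : Set R} (hS : ∀ a, ∃ c ∈ S, ∃ b, a = c + 2 * b)
    {A B C D g : G} {a b c d : R} (hA : Represents π A a) (hB : Represents π B b)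
    (hC : Represents π C c) (hD : Represents π D d) :
    IsImage π S A B C D g ↔ ∃ h : a * d - b * c = 1, g = π (slMat a b c d h) := by
  have hu {t : R} : Commute (π (upper t)) (π (upper 1)) :=
    (hπ.commute_upper_iff_represents hR.eq_zero_of_mul_self hs).2 ⟨t, represents_upper t⟩
  have hU {t : R} : IsUpper π S (π (upper t)) := (hR.isUpper_iff hπ hs hS).2 ⟨t, rfl⟩
  have hr (t : R) : Represents π (π (upper t)) t := represents_upper t
  constructor
  · rintro ⟨e, x, y, z, p, q, r, s, t, ⟨he, hx, hy, hz⟩, ⟨hp, hq, hr', hs', ht⟩,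
      ⟨h₁, h₂, h₃, h₄, h₅⟩, ⟨e₁, e₂, e₃, e₄⟩, rfl⟩
    obtain ⟨e, rfl⟩ := (hR.isUpper_iff hπ hs hS).1 he
    obtain ⟨x, rfl⟩ := (hR.isUpper_iff hπ hs hS).1 hx
    obtain ⟨y, rfl⟩ := (hR.isUpper_iff hπ hs hS).1 hy
    obtain ⟨z, rfl⟩ := (hR.isUpper_iff hπ hs hS).1 hz
    replace hp := hR.represents_value hπ hs hp
    replace hq := hR.represents_value hπ hs hq
    replace hr' := hR.represents_value hπ hs hr'
    replace hs' := hR.represents_value hπ hs hs'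
    replace ht := hR.represents_value hπ hs ht
    rw [hR.isProduct_iff hπ hs (hr x) (hr y) hp] at h₁
    rw [hR.isProduct_iff hπ hs hA (hr z) hq] at h₂
    rw [hR.isProduct_iff hπ hs (hr e) hA hr'] at h₃
    rw [hR.isProduct_iff hπ hs hC (hr z) hs'] at h₄
    rw [hR.isProduct_iff hπ hs (hr e) (hr x) ht] at h₅
    rw [hR.sameValue_iff hπ hA ((hr 1).mul hp), ← h₁] at e₁
    rw [hR.sameValue_iff hπ hB (hq.mul (hr x)), ← h₂] at e₂
    rw [hR.sameValue_iff hπ hC (hr'.mul (hr y)), ← h₃] at e₃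
    rw [hR.sameValue_iff hπ hD ((hs'.mul (hr 1)).mul ht), ← h₄, ← h₅] at e₄
    -- The determinant condition follows from the entry equations, so the formula does not have to
    -- impose it.
    have hdet : a * d - b * c = 1 := by
      rw [e₂, e₄, e₃, e₁]
      ring
    refine ⟨hdet, ?_⟩
    rw [eq_lower_upper_product (slMat a b c d hdet) e₁ e₂ e₃ e₄, toLower_upper, toLower_upper]
    simp only [map_mul]
  · rintro ⟨h, rfl⟩
    obtain ⟨e, u, hu'⟩ := hR.exists_isUnit a b c d h
    obtain ⟨x, z, e₁, e₂, e₄⟩ := lower_upper_factorization (slMat a b c d h) e u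
      (by simp [hu'])
    have e₃ : slMat a b c d h 1 0 = e * slMat a b c d h 0 0 + u := by simp [hu']
    refine ⟨π (upper e), π (upper x), π (upper u), π (upper z), π (upper (x * u)),
      π (upper (a * z)), π (upper (e * a)), π (upper (c * z)), π (upper (e * x)),
      ⟨hU, hU, hU, hU⟩, ⟨hu, hu, hu, hu, hu⟩, ⟨?_, ?_, ?_, ?_, ?_⟩, ⟨?_, ?_, ?_, ?_⟩, ?_⟩
    · exact (hR.isProduct_iff hπ hs (hr _) (hr _) (hr _)).2 rfl
    · exact (hR.isProduct_iff hπ hs hA (hr _) (hr _)).2 rfl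
    · exact (hR.isProduct_iff hπ hs (hr _) hA (hr _)).2 rfl
    · exact (hR.isProduct_iff hπ hs hC (hr _) (hr _)).2 rfl
    · exact (hR.isProduct_iff hπ hs (hr _) (hr _) (hr _)).2 rfl
    · exact (hR.sameValue_iff hπ hA ((hr _).mul (hr _))).2 e₁
    · exact (hR.sameValue_iff hπ hB ((hr _).mul (hr _))).2 e₂
    · exact (hR.sameValue_iff hπ hC ((hr _).mul (hr _))).2 e₃
    · exact (hR.sameValue_iff hπ hD (((hr _).mul (hr _)).mul (hr _))).2 e₄
    · rw [eq_lower_upper_product _ e₁ e₂ e₃ e₄, toLower_upper, toLower_upper]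
      simp only [map_mul]

end Semantics

end GroupPredicates

/-! ### The two interpretations and their composites -/

section Interpretations

variable {R : Type*} [CommRing R] {G : Type*} [Group G]

/-- The determinant of the matrix with the given four entries is one. -/
def HasDetOne (t : Fin 4 → R) : Prop := t 0 * t 3 - t 1 * t 2 = 1

/-- The image in `G` of the matrix with the given four entries. -/
noncomputable def imageOf (π : SL(2, R) →* G) (t : Fin 4 → R) : G :=
  open Classical in if h : HasDetOne t then π (slMat (t 0) (t 1) (t 2) (t 3) h) else 1

/-- Multiplication of two by two matrices on the level of entries. -/
def mulEntries (s t : Fin 4 → R) : Fin 4 → R :=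
  ![s 0 * t 0 + s 1 * t 2, s 0 * t 1 + s 1 * t 3, s 2 * t 0 + s 3 * t 2, s 2 * t 1 + s 3 * t 3]

/-- The adjugate of a two by two matrix on the level of entries. -/
def invEntries (t : Fin 4 → R) : Fin 4 → R := ![t 3, -t 1, -t 2, t 0]

theorem HasDetOne.mulEntries {s t : Fin 4 → R} (hs : HasDetOne s) (ht : HasDetOne t) :
    HasDetOne (mulEntries s t) := by
  unfold HasDetOne at *
  change (s 0 * t 0 + s 1 * t 2) * (s 2 * t 1 + s 3 * t 3) -
    (s 0 * t 1 + s 1 * t 3) * (s 2 * t 0 + s 3 * t 2) = 1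
  linear_combination (t 0 * t 3 - t 1 * t 2) * hs + ht

theorem HasDetOne.invEntries {t : Fin 4 → R} (ht : HasDetOne t) :
    HasDetOne (invEntries t) := by
  unfold HasDetOne at *
  change t 3 * t 0 - (-t 1) * (-t 2) = 1
  linear_combination ht

theorem imageOf_eq {π : SL(2, R) →* G} {t : Fin 4 → R} (h : HasDetOne t) :
    imageOf π t = π (slMat (t 0) (t 1) (t 2) (t 3) h) := dif_pos h

theorem imageOf_mulEntries {π : SL(2, R) →* G} {s t : Fin 4 → R} (hs : HasDetOne s)
    (ht : HasDetOne t) : imageOf π (mulEntries s t) = imageOf π s * imageOf π t := by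
  rw [imageOf_eq hs, imageOf_eq ht, imageOf_eq (hs.mulEntries ht), ← map_mul]
  congr 1
  apply sl_ext <;> rw [sl_mul_apply] <;> rfl

theorem imageOf_invEntries {π : SL(2, R) →* G} {t : Fin 4 → R} (ht : HasDetOne t) :
    imageOf π (invEntries t) = (imageOf π t)⁻¹ := by
  rw [imageOf_eq ht, imageOf_eq ht.invEntries, ← map_inv]
  congr 1
  apply sl_ext
  · rw [sl_inv_zero_zero]; rfl
  · rw [sl_inv_zero_one]; rfl
  · rw [sl_inv_one_zero]; rfl
  · rw [sl_inv_one_one]; rfl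

section Definability

variable {α : Type*} {s t : (α → R) → Fin 4 → R}

theorem defTerm_mulEntries (hs : ∀ i, DefTerm FirstOrder.Language.ring fun x => s x i)
    (ht : ∀ i, DefTerm FirstOrder.Language.ring fun x => t x i) (i : Fin 4) :
    DefTerm FirstOrder.Language.ring fun x => mulEntries (s x) (t x) i := by
  fin_cases i
  · exact ((hs 0).rmul (ht 0)).add ((hs 1).rmul (ht 2))
  · exact ((hs 0).rmul (ht 1)).add ((hs 1).rmul (ht 3))
  · exact ((hs 2).rmul (ht 0)).add ((hs 3).rmul (ht 2))
  · exact ((hs 2).rmul (ht 1)).add ((hs 3).rmul (ht 3))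

theorem defTerm_invEntries (ht : ∀ i, DefTerm FirstOrder.Language.ring fun x => t x i)
    (i : Fin 4) : DefTerm FirstOrder.Language.ring fun x => invEntries (t x) i := by
  fin_cases i
  · exact ht 3
  · exact (ht 1).neg
  · exact (ht 2).neg
  · exact ht 0

theorem defPred_hasDetOne (ht : ∀ i, DefTerm FirstOrder.Language.ring fun x => t x i) :
    DefPred FirstOrder.Language.ring fun x => HasDetOne (t x) :=
  .eq (((ht 0).rmul (ht 3)).sub ((ht 1).rmul (ht 2))) (.const 1)

end Definability

/-- The kernel of `π` is definable in `R`, in terms of the matrix entries. -/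
def DefinableKernel (π : SL(2, R) →* G) : Prop :=
  DefPred FirstOrder.Language.ring fun t : Fin 4 → R => HasDetOne t ∧ imageOf π t = 1

/-- The interpretation of a quotient of `SL₂(R)` in `R` by matrix entries. -/
noncomputable def matrixInterpretation (π : SL(2, R) →* G) (hs : Function.Surjective π)
    (hk : DefinableKernel π) : Interpretation FirstOrder.Language.ring groupLang R G where
  dim := 4
  dom := {t | HasDetOne t}
  toFun := imageOf π
  surjOn := by
    rintro g -
    obtain ⟨A, rfl⟩ := hs g
    have h : HasDetOne ![A 0 0, A 0 1, A 1 0, A 1 1] := sl_det A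
    refine ⟨_, h, ?_⟩
    rw [imageOf_eq h]
    congr 1
    apply sl_ext <;> rfl
  definable_dom := defPred_hasDetOne (t := fun x => x) fun i => .var i
  definable_eq := by
    have hv (k : Fin 2) (i : Fin 4) :
        DefTerm FirstOrder.Language.ring fun x : Fin 2 × Fin 4 → R => x (k, i) := .var (k, i)
    refine DefPred.congr (P := fun x => (HasDetOne (fun i => x (0, i)) ∧
        HasDetOne (fun i => x (1, i))) ∧ _)
      (((defPred_hasDetOne (hv 0)).and (defPred_hasDetOne (hv 1))).and
        (hk.subst (defTerm_mulEntries (hv 0) (defTerm_invEntries (hv 1))))) fun x => ?_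
    change (∀ k : Fin 2, HasDetOne (fun i => x (k, i))) ∧ imageOf π _ = imageOf π _ ↔ _
    rw [Fin.forall_fin_two]
    refine and_congr_right fun h => ?_
    -- Equality in `G` is membership of a quotient in the kernel, whose definability is assumed. The
    -- graphs of multiplication and inversion are treated the same way.
    rw [imageOf_mulEntries h.1 h.2.invEntries, imageOf_invEntries h.2, mul_inv_eq_one]
    exact ⟨fun h' => ⟨h.1.mulEntries h.2.invEntries, h'⟩, fun h' => h'.2⟩
  definable_fun := by
    intro n g
    cases g with
    | mul =>
      have hv (k : Fin 3) (i : Fin 4) :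
          DefTerm FirstOrder.Language.ring fun x : Fin 3 × Fin 4 → R => x (k, i) := .var (k, i)
      refine DefPred.congr (P := fun x => (HasDetOne (fun i => x (0, i)) ∧
          HasDetOne (fun i => x (1, i)) ∧ HasDetOne (fun i => x (2, i))) ∧ _)
        (((defPred_hasDetOne (hv 0)).and ((defPred_hasDetOne (hv 1)).and
          (defPred_hasDetOne (hv 2)))).and (hk.subst (defTerm_mulEntries
            (defTerm_mulEntries (hv 0) (hv 1)) (defTerm_invEntries (hv 2))))) fun x => ?_
      change (∀ k : Fin 3, HasDetOne (fun i => x (k, i))) ∧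
        imageOf π (fun i => x (0, i)) * imageOf π (fun i => x (1, i)) =
          imageOf π (fun i => x (2, i)) ↔ _
      rw [Fin.forall_fin_succ, Fin.forall_fin_two]
      refine and_congr_right fun h => ?_
      obtain ⟨h0, h1, h2⟩ : HasDetOne (fun i => x (0, i)) ∧ HasDetOne (fun i => x (1, i)) ∧
        HasDetOne (fun i => x (2, i)) := h
      rw [imageOf_mulEntries (h0.mulEntries h1) h2.invEntries, imageOf_invEntries h2,
        imageOf_mulEntries h0 h1, mul_inv_eq_one]
      exact ⟨fun h' => ⟨(h0.mulEntries h1).mulEntries h2.invEntries, h'⟩, fun h' => h'.2⟩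
    | inv =>
      have hv (k : Fin 2) (i : Fin 4) :
          DefTerm FirstOrder.Language.ring fun x : Fin 2 × Fin 4 → R => x (k, i) := .var (k, i)
      refine DefPred.congr (P := fun x => (HasDetOne (fun i => x (0, i)) ∧
          HasDetOne (fun i => x (1, i))) ∧ _)
        (((defPred_hasDetOne (hv 0)).and (defPred_hasDetOne (hv 1))).and (hk.subst
          (defTerm_mulEntries (defTerm_invEntries (hv 0)) (defTerm_invEntries (hv 1)))))
        fun x => ?_
      change (∀ k : Fin 2, HasDetOne (fun i => x (k, i))) ∧
        (imageOf π (fun i => x (0, i)))⁻¹ = imageOf π (fun i => x (1, i)) ↔ _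
      rw [Fin.forall_fin_two]
      refine and_congr_right fun h => ?_
      rw [imageOf_mulEntries h.1.invEntries h.2.invEntries, imageOf_invEntries h.1,
        imageOf_invEntries h.2, mul_inv_eq_one]
      exact ⟨fun h' => ⟨h.1.invEntries.mulEntries h.2.invEntries, h'⟩, fun h' => h'.2⟩
    | one =>
      refine DefPred.congr (hk.subst (t := fun (x : Fin 1 × Fin 4 → R) i => x (0, i))
        fun i => .var (0, i)) fun x => ?_
      change (∀ k : Fin 1, HasDetOne (fun i => x (k, i))) ∧
        1 = imageOf π (fun i => x (0, i)) ↔ _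
      rw [Fin.forall_fin_one, eq_comm]
  definable_rel := fun _ r => r.elim

/-- The interpretation of `R` in a quotient of `SL₂(R)` by the upper unitriangular group. -/
noncomputable def unipotentInterpretation (hR : UnitSquareRing R) (π : SL(2, R) →* G)
    (hπ : ScalarKernel π) (hs : Function.Surjective π) :
    Interpretation groupLang FirstOrder.Language.ring G R where
  dim := 1
  dom := {x | Commute (x 0) (π (upper 1))}
  toFun x := value π (x 0)
  surjOn := by
    rintro t -
    refine ⟨fun _ => π (upper t), ?_, hπ.value_eq (represents_upper t)⟩
    exact (hπ.commute_upper_iff_represents hR.eq_zero_of_mul_self hs).2 ⟨t, represents_upper t⟩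
  definable_dom := defPred_commute (.var 0) (.const _)
  definable_eq := by
    refine DefPred.congr (P := fun x : Fin 2 × Fin 1 → G => (Commute (x (0, 0)) (π (upper 1)) ∧
      Commute (x (1, 0)) (π (upper 1))) ∧ SameValue π (x (0, 0)) (x (1, 0)))
      (((defPred_commute (.var _) (.const _)).and (defPred_commute (.var _) (.const _))).and
        (defPred_sameValue (.var _) (.var _))) fun x => ?_
    change (∀ k : Fin 2, Commute (x (k, 0)) (π (upper 1))) ∧
      value π (x (0, 0)) = value π (x (1, 0)) ↔ _
    rw [Fin.forall_fin_two]
    refine and_congr_right fun h => ?_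
    exact (hR.sameValue_iff hπ (hR.represents_value hπ hs h.1)
      (hR.represents_value hπ hs h.2)).symm
  definable_fun := by
    intro n g
    have h1 : Represents π 1 (0 : R) := ⟨1, map_one π, by simp, by simp, by simp⟩
    cases g with
    | add =>
      refine DefPred.congr (P := fun x : Fin 3 × Fin 1 → G => (Commute (x (0, 0)) (π (upper 1)) ∧
        Commute (x (1, 0)) (π (upper 1)) ∧ Commute (x (2, 0)) (π (upper 1))) ∧
          SameValue π (x (0, 0) * x (1, 0)) (x (2, 0)))
        (((defPred_commute (.var _) (.const _)).and ((defPred_commute (.var _) (.const _)).and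
          (defPred_commute (.var _) (.const _)))).and
          (defPred_sameValue (.mul (.var _) (.var _)) (.var _))) fun x => ?_
      change (∀ k : Fin 3, Commute (x (k, 0)) (π (upper 1))) ∧
        value π (x (0, 0)) + value π (x (1, 0)) = value π (x (2, 0)) ↔ _
      rw [Fin.forall_fin_succ, Fin.forall_fin_two]
      refine and_congr_right fun h => ?_
      exact (hR.sameValue_iff hπ ((hR.represents_value hπ hs h.1).mul
        (hR.represents_value hπ hs h.2.1)) (hR.represents_value hπ hs h.2.2)).symm
    | mul =>
      refine DefPred.congr (P := fun x : Fin 3 × Fin 1 → G => (Commute (x (0, 0)) (π (upper 1)) ∧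
        Commute (x (1, 0)) (π (upper 1)) ∧ Commute (x (2, 0)) (π (upper 1))) ∧
          IsProduct π (x (0, 0)) (x (1, 0)) (x (2, 0)))
        (((defPred_commute (.var _) (.const _)).and ((defPred_commute (.var _) (.const _)).and
          (defPred_commute (.var _) (.const _)))).and
          (defPred_isProduct (.var _) (.var _) (.var _))) fun x => ?_
      change (∀ k : Fin 3, Commute (x (k, 0)) (π (upper 1))) ∧
        value π (x (0, 0)) * value π (x (1, 0)) = value π (x (2, 0)) ↔ _
      rw [Fin.forall_fin_succ, Fin.forall_fin_two]
      refine and_congr_right fun h => ?_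
      exact (hR.isProduct_iff hπ hs (hR.represents_value hπ hs h.1)
        (hR.represents_value hπ hs h.2.1) (hR.represents_value hπ hs h.2.2)).symm
    | neg =>
      refine DefPred.congr (P := fun x : Fin 2 × Fin 1 → G => (Commute (x (0, 0)) (π (upper 1)) ∧
        Commute (x (1, 0)) (π (upper 1))) ∧ SameValue π (x (0, 0))⁻¹ (x (1, 0)))
        (((defPred_commute (.var _) (.const _)).and (defPred_commute (.var _) (.const _))).and
          (defPred_sameValue (.inv (.var _)) (.var _))) fun x => ?_
      change (∀ k : Fin 2, Commute (x (k, 0)) (π (upper 1))) ∧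
        -value π (x (0, 0)) = value π (x (1, 0)) ↔ _
      rw [Fin.forall_fin_two]
      refine and_congr_right fun h => ?_
      exact (hR.sameValue_iff hπ (hR.represents_value hπ hs h.1).inv
        (hR.represents_value hπ hs h.2)).symm
    | zero =>
      refine DefPred.congr (P := fun x : Fin 1 × Fin 1 → G => Commute (x (0, 0)) (π (upper 1)) ∧
        SameValue π 1 (x (0, 0))) ((defPred_commute (.var _) (.const _)).and
          (defPred_sameValue (.const _) (.var _))) fun x => ?_
      change (∀ k : Fin 1, Commute (x (k, 0)) (π (upper 1))) ∧ 0 = value π (x (0, 0)) ↔ _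
      rw [Fin.forall_fin_one]
      exact and_congr_right fun h =>
        (hR.sameValue_iff hπ h1 (hR.represents_value hπ hs h)).symm
    | one =>
      refine DefPred.congr (P := fun x : Fin 1 × Fin 1 → G => Commute (x (0, 0)) (π (upper 1)) ∧
        SameValue π (π (upper 1)) (x (0, 0))) ((defPred_commute (.var _) (.const _)).and
          (defPred_sameValue (.const _) (.var _))) fun x => ?_
      change (∀ k : Fin 1, Commute (x (k, 0)) (π (upper 1))) ∧ 1 = value π (x (0, 0)) ↔ _
      rw [Fin.forall_fin_one]
      exact and_congr_right fun h =>
        (hR.sameValue_iff hπ (represents_upper 1) (hR.represents_value hπ hs h)).symm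
  definable_rel := fun _ r => r.elim

theorem UnitSquareRing.biInterpretable (hR : UnitSquareRing R) (π : SL(2, R) →* G)
    (hπ : ScalarKernel π) (hs : Function.Surjective π) (hk : DefinableKernel π) :
    RingGroupBiInterpretable R G := by
  refine ⟨matrixInterpretation π hs hk, unipotentInterpretation hR π hπ hs, ?_, ?_⟩
  · let v (i : Fin 4) : (Fin 1 × Fin 4) ⊕ Unit := Sum.inl (0, i)
    have hv (i : Fin 4) : DefTerm FirstOrder.Language.ring
        fun x : (Fin 1 × Fin 4) ⊕ Unit → R => x (v i) := .var _
    -- On `R`, the composite sends the entries of an upper triangular matrix with equal diagonal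
    -- entries to the product of the two entries in its first row.
    refine DefPred.congr (P := fun x : (Fin 1 × Fin 4) ⊕ Unit → R =>
      (HasDetOne (fun i => x (v i)) ∧ x (v 2) = 0 ∧ x (v 0) = x (v 3)) ∧
        x (v 0) * x (v 1) = x (Sum.inr ()))
      (.and ((defPred_hasDetOne hv).and (.and (.eq (hv 2) (.const 0)) (.eq (hv 0) (hv 3))))
        (.eq ((hv 0).rmul (hv 1)) (.var _))) fun x => ?_
    change ((∀ k : Fin 1, HasDetOne (fun i => x (Sum.inl (k, i)))) ∧
      Commute (imageOf π (fun i => x (v i))) (π (upper 1))) ∧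
        value π (imageOf π (fun i => x (v i))) = x (Sum.inr ()) ↔ _
    rw [Fin.forall_fin_one]
    by_cases h : HasDetOne (fun i => x (v i))
    · rw [imageOf_eq h, hπ.commute_upper_iff hR.eq_zero_of_mul_self]
      refine and_congr_right fun h' => ?_
      rw [hπ.value_eq (t := x (v 0) * x (v 1)) ⟨_, rfl, h'.2.1, h'.2.2, rfl⟩]
    · exact ⟨fun h' => absurd h'.1.1 h, fun h' => absurd h'.1.1 h⟩
  · obtain ⟨S, hSf, hS⟩ := hR.exists_finite
    let v (i : Fin 4) : (Fin 4 × Fin 1) ⊕ Unit := Sum.inl (i, 0)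
    have hv (i : Fin 4) : DefTerm groupLang
        fun x : (Fin 4 × Fin 1) ⊕ Unit → G => x (v i) := .var _
    refine DefPred.congr (P := fun x : (Fin 4 × Fin 1) ⊕ Unit → G =>
      (Commute (x (v 0)) (π (upper 1)) ∧ Commute (x (v 1)) (π (upper 1)) ∧
        Commute (x (v 2)) (π (upper 1)) ∧ Commute (x (v 3)) (π (upper 1))) ∧
        IsImage π S (x (v 0)) (x (v 1)) (x (v 2)) (x (v 3)) (x (Sum.inr ())))
      (.and (.and (defPred_commute (hv _) (.const _)) (.and (defPred_commute (hv _) (.const _))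
        (.and (defPred_commute (hv _) (.const _)) (defPred_commute (hv _) (.const _)))))
        ((defPred_isImage hSf).subst
          (t := fun x => ![x (v 0), x (v 1), x (v 2), x (v 3), x (Sum.inr ())]) fun i => ?_))
      fun x => ?_
    · fin_cases i
      · exact hv 0
      · exact hv 1
      · exact hv 2
      · exact hv 3
      · exact .var _
    change ((∀ k : Fin 4, Commute (x (v k)) (π (upper 1))) ∧
      HasDetOne (fun i => value π (x (v i)))) ∧
        imageOf π (fun i => value π (x (v i))) = x (Sum.inr ()) ↔ _
    rw [Fin.forall_fin_succ, Fin.forall_fin_succ, Fin.forall_fin_two, and_assoc]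
    refine and_congr_right fun h => ?_
    refine Iff.trans ?_ (hR.isImage_iff hπ hs hS (hR.represents_value hπ hs h.1)
      (hR.represents_value hπ hs h.2.1) (hR.represents_value hπ hs h.2.2.1)
      (hR.represents_value hπ hs h.2.2.2)).symm
    constructor
    · rintro ⟨h1, h2⟩
      rw [imageOf_eq (t := fun i => value π (x (v i))) h1] at h2
      exact ⟨h1, h2.symm⟩
    · rintro ⟨h1, h2⟩
      exact ⟨h1, (imageOf_eq (t := fun i => value π (x (v i))) h1).trans h2.symm⟩

end Interpretations

/-! ### The kernels of the three quotient maps -/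

section Quotients

variable {R : Type*} [CommRing R]

theorem imageOf_eq_one_iff {G : Type*} [Group G] {π : SL(2, R) →* G} {P : (Fin 4 → R) → Prop}
    (h : ∀ A, π A = 1 ↔ P ![A 0 0, A 0 1, A 1 0, A 1 1]) (t : Fin 4 → R) :
    HasDetOne t ∧ imageOf π t = 1 ↔ HasDetOne t ∧ P t := by
  refine and_congr_right fun ht => ?_
  rw [imageOf_eq ht, h]
  have : ![t 0, t 1, t 2, t 3] = t := by
    funext i
    fin_cases i <;> rfl
  exact iff_of_eq (congrArg P this)

/-- Commuting with `upper 1` and `lower 1` already forces a matrix to be scalar. -/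
theorem mem_center_sl_iff (A : SL(2, R)) :
    A ∈ Subgroup.center SL(2, R) ↔ A 0 1 = 0 ∧ A 1 0 = 0 ∧ A 0 0 = A 1 1 := by
  rw [Subgroup.mem_center_iff]
  constructor
  · intro h
    have hu := h (upper 1)
    have hl := h (lower 1)
    have h1 := congrArg (fun B : SL(2, R) => B 0 0) hu
    have h2 := congrArg (fun B : SL(2, R) => B 0 1) hu
    have h3 := congrArg (fun B : SL(2, R) => B 0 0) hl
    simp only [sl_mul_apply, upper_zero_zero, upper_zero_one, upper_one_zero, upper_one_one,
      lower_zero_zero, lower_zero_one, lower_one_zero] at h1 h2 h3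
    exact ⟨by linear_combination -h3, by linear_combination h1, by linear_combination -h2⟩
  · rintro ⟨h1, h2, h3⟩ B
    apply sl_ext <;> simp only [sl_mul_apply, h1, h2, h3] <;> ring

theorem mem_zpowers_neg_one_iff (A : SL(2, R)) :
    A ∈ Subgroup.zpowers (-1 : SL(2, R)) ↔ A = 1 ∨ A = -1 := by
  constructor
  · rintro ⟨k, rfl⟩
    rcases Int.even_or_odd k with hk | hk
    · exact Or.inl hk.neg_one_zpow
    · exact Or.inr hk.neg_one_zpow
  · rintro (rfl | rfl)
    · exact one_mem _
    · exact Subgroup.mem_zpowers _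

theorem UnitSquareRing.biInterpretableWithSL2 (hR : UnitSquareRing R) :
    BiInterpretableWithSL2 R := by
  have hv (i : Fin 4) : DefTerm FirstOrder.Language.ring fun x : Fin 4 → R => x i := .var i
  have hd : DefPred FirstOrder.Language.ring fun t : Fin 4 → R => HasDetOne t :=
    defPred_hasDetOne hv
  have hone (A : SL(2, R)) : A = 1 ↔ A 0 0 = 1 ∧ A 0 1 = 0 ∧ A 1 0 = 0 ∧ A 1 1 = 1 := by
    constructor
    · rintro rfl
      simp
    · rintro ⟨h1, h2, h3, h4⟩
      apply sl_ext <;> simp [*]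
  have hneg (A : SL(2, R)) : A = -1 ↔ A 0 0 = -1 ∧ A 0 1 = 0 ∧ A 1 0 = 0 ∧ A 1 1 = -1 := by
    constructor
    · rintro rfl
      simp
    · rintro ⟨h1, h2, h3, h4⟩
      apply sl_ext <;> simp [*]
  refine ⟨hR.biInterpretable (MonoidHom.id _) ?_ Function.surjective_id ?_,
    hR.biInterpretable (QuotientGroup.mk' _) ?_ (QuotientGroup.mk'_surjective _) ?_,
    hR.biInterpretable (QuotientGroup.mk' _) ?_ (QuotientGroup.mk'_surjective _) ?_⟩
  · rintro A h
    obtain ⟨h1, h2, h3, h4⟩ := (hone A).1 h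
    exact ⟨h2, h3, h1.trans h4.symm⟩
  · exact (hd.and (.and (.eq (hv 0) (.const 1)) (.and (.eq (hv 1) (.const 0))
      (.and (.eq (hv 2) (.const 0)) (.eq (hv 3) (.const 1)))))).congr
      (imageOf_eq_one_iff (P := fun t => t 0 = 1 ∧ t 1 = 0 ∧ t 2 = 0 ∧ t 3 = 1) hone)
  · intro A h
    rw [QuotientGroup.mk'_apply, QuotientGroup.eq_one_iff, mem_zpowers_neg_one_iff, hone,
      hneg] at h
    rcases h with ⟨h1, h2, h3, h4⟩ | ⟨h1, h2, h3, h4⟩ <;> exact ⟨h2, h3, h1.trans h4.symm⟩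
  · refine (hd.and (.or (.and (.eq (hv 0) (.const 1)) (.and (.eq (hv 1) (.const 0))
      (.and (.eq (hv 2) (.const 0)) (.eq (hv 3) (.const 1))))) (.and (.eq (hv 0) (.const (-1)))
      (.and (.eq (hv 1) (.const 0)) (.and (.eq (hv 2) (.const 0))
      (.eq (hv 3) (.const (-1)))))))).congr
      (imageOf_eq_one_iff (P := fun t => (t 0 = 1 ∧ t 1 = 0 ∧ t 2 = 0 ∧ t 3 = 1) ∨
        (t 0 = -1 ∧ t 1 = 0 ∧ t 2 = 0 ∧ t 3 = -1)) fun A => ?_)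
    rw [QuotientGroup.mk'_apply, QuotientGroup.eq_one_iff, mem_zpowers_neg_one_iff, hone, hneg]
    rfl
  · intro A h
    rw [QuotientGroup.mk'_apply, QuotientGroup.eq_one_iff] at h
    exact (mem_center_sl_iff A).1 h
  · refine (hd.and (.and (.eq (hv 1) (.const 0)) (.and (.eq (hv 2) (.const 0))
      (.eq (hv 0) (hv 3))))).congr
      (imageOf_eq_one_iff (P := fun t => t 1 = 0 ∧ t 2 = 0 ∧ t 0 = t 3) fun A => ?_)
    rw [QuotientGroup.mk'_apply, QuotientGroup.eq_one_iff]
    exact mem_center_sl_iff A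

end Quotients

/-! ### Local rings and their products -/

section LocalRings

variable {O : Type*} [CommRing O] [IsLocalRing O]

theorem isUnit_add_of_not_isUnit {a b : O} (ha : ¬IsUnit a) (hb : IsUnit b) :
    IsUnit (a + b) := by
  by_contra h
  have h1 : a + b + -a ∈ nonunits O :=
    IsLocalRing.nonunits_add h (fun h' => ha ((IsUnit.neg_iff a).1 h'))
  rw [add_neg_cancel_comm] at h1
  exact h1 hb

/-- The source is `(x + 1) ^ 2 - (x - 1) ^ 2 = 4 * x` with `x = 6 * t`. If `6` is not a unit, both
`6 * t + 1` and `6 * t - 1` are units. Otherwise `2` and `3` are units, and a failure of either can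
be repaired by shifting. -/
theorem IsLocalRing.exists_unit_squares (t : O) : ∃ r : Fin 4 → Oˣ,
    24 * t = (r 0 : O) ^ 2 - (r 1 : O) ^ 2 + (r 2 : O) ^ 2 - (r 3 : O) ^ 2 := by
  suffices h : ∃ a b c d : O, (IsUnit a ∧ IsUnit b ∧ IsUnit c ∧ IsUnit d) ∧
      24 * t = a ^ 2 - b ^ 2 + c ^ 2 - d ^ 2 by
    obtain ⟨_, _, _, _, ⟨⟨a, rfl⟩, ⟨b, rfl⟩, ⟨c, rfl⟩, ⟨d, rfl⟩⟩, h⟩ := h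
    exact ⟨![a, b, c, d], h⟩
  by_cases h1 : IsUnit (6 * t + 1)
  · by_cases h2 : IsUnit (6 * t - 1)
    · exact ⟨6 * t + 1, 6 * t - 1, 1, 1, ⟨h1, h2, isUnit_one, isUnit_one⟩, by ring⟩
    have h6 : IsUnit (6 : O) := by
      by_contra h6
      have : ¬IsUnit (6 * t) := fun h => h6 (isUnit_of_mul_isUnit_left h)
      exact h2 (by rw [sub_eq_add_neg]; exact isUnit_add_of_not_isUnit this isUnit_one.neg)
    have h2' : IsUnit (2 : O) :=
      isUnit_of_mul_isUnit_left (y := 3) (by norm_num; exact h6)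
    have h3' : IsUnit (3 : O) :=
      isUnit_of_mul_isUnit_left (y := 2) (by norm_num; exact h6)
    -- Here `(6 * t + 3) ^ 2 - (6 * t + 1) ^ 2 = 24 * t + 8`, and `1 - 9` cancels the `8`. Both
    -- bases are a nonunit plus a unit.
    refine ⟨-1, -3, (6 * t - 1) + 2 * 2, (6 * t - 1) + 2, ⟨isUnit_one.neg, h3'.neg,
      isUnit_add_of_not_isUnit h2 (h2'.mul h2'), isUnit_add_of_not_isUnit h2 h2'⟩, by ring⟩
  · have h6 : IsUnit (6 : O) := by
      by_contra h6
      have : ¬IsUnit (6 * t) := fun h => h6 (isUnit_of_mul_isUnit_left h)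
      exact h1 (isUnit_add_of_not_isUnit this isUnit_one)
    have h2' : IsUnit (2 : O) :=
      isUnit_of_mul_isUnit_left (y := 3) (by norm_num; exact h6)
    have h3' : IsUnit (3 : O) :=
      isUnit_of_mul_isUnit_left (y := 2) (by norm_num; exact h6)
    -- The mirror image: `(6 * t - 1) ^ 2 - (6 * t - 3) ^ 2 = 24 * t - 8`, corrected by `9 - 1`.
    refine ⟨3, 1, (6 * t + 1) + -2, (6 * t + 1) + -(2 * 2), ⟨h3', isUnit_one,
      isUnit_add_of_not_isUnit h1 h2'.neg, isUnit_add_of_not_isUnit h1 (h2'.mul h2').neg⟩,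
      by ring⟩

/-- If `c` is not a unit, the determinant makes `a` one, and then `c + a` is a unit. -/
theorem IsLocalRing.exists_isUnit_sub_mul (a b c d : O) (h : a * d - b * c = 1) :
    ∃ e, IsUnit (c - e * a) := by
  by_cases hc : IsUnit c
  · exact ⟨0, by simpa using hc⟩
  · have ha : IsUnit a := by
      refine isUnit_of_mul_isUnit_left (y := d) ?_
      rw [show a * d = b * c + 1 by linear_combination h]
      exact isUnit_add_of_not_isUnit (fun h => hc (isUnit_of_mul_isUnit_right h)) isUnit_one
    exact ⟨-1, by simpa using isUnit_add_of_not_isUnit hc ha⟩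

theorem UnitSquareRing.of_isLocalRing [IsDomain O] (h24 : (24 : O) ≠ 0)
    (hf : ∃ S : Set O, S.Finite ∧ ∀ a, ∃ c ∈ S, ∃ b, a = c + 2 * b) : UnitSquareRing O where
  eq_zero_of_mul_self _ := mul_self_eq_zero.1
  eq_zero_of_mul _ h := (mul_eq_zero.1 h).resolve_left h24
  exists_unit_squares t := by
    obtain ⟨r, hr⟩ := IsLocalRing.exists_unit_squares t
    exact ⟨_, _, _, _, hr⟩
  exists_finite := hf
  exists_isUnit := IsLocalRing.exists_isUnit_sub_mul

end LocalRings

theorem exists_finite_of_isUnit_two {R : Type*} [CommRing R] (h : IsUnit (2 : R)) :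
    ∃ S : Set R, S.Finite ∧ ∀ a, ∃ c ∈ S, ∃ b, a = c + 2 * b := by
  obtain ⟨b, hb⟩ := h.exists_right_inv
  refine ⟨{0}, Set.finite_singleton 0, fun a => ⟨0, rfl, b * a, ?_⟩⟩
  linear_combination (-a) * hb

theorem UnitSquareRing.of_field {F : Type*} [Field F] (h24 : (24 : F) ≠ 0) :
    UnitSquareRing F := by
  refine .of_isLocalRing h24 (exists_finite_of_isUnit_two (IsUnit.mk0 _ fun h => h24 ?_))
  rw [show (24 : F) = 2 * 12 by norm_num, h, zero_mul]

theorem UnitSquareRing.pi {ι : Type*} {O : ι → Type*} [∀ i, CommRing (O i)]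
    (h : ∀ i, UnitSquareRing (O i)) (hf : {i | ¬IsUnit (2 : O i)}.Finite) :
    UnitSquareRing (∀ i, O i) where
  eq_zero_of_mul_self c hc := funext fun i => (h i).eq_zero_of_mul_self _ (congrFun hc i)
  eq_zero_of_mul a ha := funext fun i => (h i).eq_zero_of_mul _ (congrFun ha i)
  exists_unit_squares t := by
    choose r₁ r₂ r₃ r₄ hr using fun i => (h i).exists_unit_squares (t i)
    exact ⟨MulEquiv.piUnits.symm r₁, MulEquiv.piUnits.symm r₂, MulEquiv.piUnits.symm r₃,
      MulEquiv.piUnits.symm r₄, funext hr⟩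
  exists_finite := by
    classical
    choose S hS hS' using fun i => (h i).exists_finite
    have := hf.to_subtype
    have hfin : ∀ i, Finite (S i) := fun i => (hS i).to_subtype
    -- Representatives vary only over the finitely many coordinates where `2` is not invertible;
    -- elsewhere `0` represents everything.
    refine ⟨Set.range fun (φ : ∀ i : {i | ¬IsUnit (2 : O i)}, S i) i =>
      if hi : ¬IsUnit (2 : O i) then (φ ⟨i, hi⟩ : O i) else 0, Set.finite_range _, fun a => ?_⟩
    choose c hc b hb using fun i => hS' i (a i)
    choose b' hb' using fun (i) (hi : ¬¬IsUnit (2 : O i)) => (not_not.1 hi).exists_right_inv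
    refine ⟨_, ⟨fun i => ⟨c i, hc i⟩, rfl⟩,
      fun i => if hi : ¬IsUnit (2 : O i) then b i else b' i hi * a i, funext fun i => ?_⟩
    by_cases hi : IsUnit (2 : O i)
    · have h1 : ¬¬IsUnit (2 : O i) := not_not.2 hi
      simp only [Pi.add_apply, Pi.mul_apply, dif_neg h1, Pi.ofNat_apply]
      linear_combination (-a i) * hb' i h1
    · simp only [Pi.add_apply, Pi.mul_apply, dif_pos hi, Pi.ofNat_apply]
      exact hb i
  exists_isUnit a b c d hd := by
    choose e he using fun i => (h i).exists_isUnit (a i) (b i) (c i) (d i) (congrFun hd i)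
    exact ⟨e, Pi.isUnit_iff.2 he⟩

theorem UnitSquareRing.prod {R S : Type*} [CommRing R] [CommRing S] (hR : UnitSquareRing R)
    (hS : UnitSquareRing S) : UnitSquareRing (R × S) where
  eq_zero_of_mul_self c hc := Prod.ext (hR.eq_zero_of_mul_self _ (congrArg Prod.fst hc))
    (hS.eq_zero_of_mul_self _ (congrArg Prod.snd hc))
  eq_zero_of_mul a ha := Prod.ext (hR.eq_zero_of_mul _ (congrArg Prod.fst ha))
    (hS.eq_zero_of_mul _ (congrArg Prod.snd ha))
  exists_unit_squares t := by
    obtain ⟨r₁, r₂, r₃, r₄, hr⟩ := hR.exists_unit_squares t.1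
    obtain ⟨s₁, s₂, s₃, s₄, hs⟩ := hS.exists_unit_squares t.2
    exact ⟨MulEquiv.prodUnits.symm (r₁, s₁), MulEquiv.prodUnits.symm (r₂, s₂),
      MulEquiv.prodUnits.symm (r₃, s₃), MulEquiv.prodUnits.symm (r₄, s₄), Prod.ext hr hs⟩
  exists_finite := by
    obtain ⟨A, hA, hA'⟩ := hR.exists_finite
    obtain ⟨B, hB, hB'⟩ := hS.exists_finite
    refine ⟨A ×ˢ B, hA.prod hB, fun a => ?_⟩
    obtain ⟨c, hc, b, hb⟩ := hA' a.1
    obtain ⟨c', hc', b', hb'⟩ := hB' a.2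
    exact ⟨(c, c'), ⟨hc, hc'⟩, (b, b'), Prod.ext hb hb'⟩
  exists_isUnit a b c d hd := by
    obtain ⟨e, he⟩ := hR.exists_isUnit a.1 b.1 c.1 d.1 (congrArg Prod.fst hd)
    obtain ⟨e', he'⟩ := hS.exists_isUnit a.2 b.2 c.2 d.2 (congrArg Prod.snd hd)
    exact ⟨(e, e'), Prod.isUnit_iff.2 ⟨he, he'⟩⟩

/-! ### Restricted products of fields -/

section RestrictedProducts

variable {ι : Type*} {K : ι → Type*} [∀ i, Field (K i)] {A : ∀ i, ValuationSubring (K i)}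

/-- A family of nonzero elements, almost all of which are local units, is a unit of the restricted
product. -/
def restrictedProductUnit (r : ∀ i, (K i)ˣ)
    (h : ∀ᶠ i in Filter.cofinite, (r i : K i) ∈ A i ∧ ((r i)⁻¹ : K i) ∈ A i) :
    (Πʳ i, [K i, A i])ˣ where
  val := ⟨fun i => r i, h.mono fun _ h => h.1⟩
  inv := ⟨fun i => (r i : K i)⁻¹, h.mono fun _ h => h.2⟩
  val_inv := RestrictedProduct.ext _ _ fun i => mul_inv_cancel₀ (r i).ne_zero
  inv_val := RestrictedProduct.ext _ _ fun i => inv_mul_cancel₀ (r i).ne_zero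

theorem ValuationSubring.coe_unit_mem {F : Type*} [Field F] {B : ValuationSubring F} (u : Bˣ) :
    ((Units.map B.subtype.toMonoidHom u : Fˣ) : F) ∈ B ∧
      ((Units.map B.subtype.toMonoidHom u : Fˣ) : F)⁻¹ ∈ B := by
  rw [← Units.val_inv_eq_inv_val, ← map_inv]
  exact ⟨(u : B).2, ((u⁻¹ : Bˣ) : B).2⟩

theorem UnitSquareRing.restrictedProduct (h24 : ∀ i, (24 : K i) ≠ 0)
    (h2 : IsUnit (2 : Πʳ i, [K i, A i])) : UnitSquareRing (Πʳ i, [K i, A i]) where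
  eq_zero_of_mul_self c hc := RestrictedProduct.ext _ _ fun i =>
    mul_self_eq_zero.1 (congrArg (fun x : Πʳ i, [K i, A i] => x i) hc)
  eq_zero_of_mul a ha := RestrictedProduct.ext _ _ fun i =>
    (mul_eq_zero.1 (congrArg (fun x : Πʳ i, [K i, A i] => x i) ha)).resolve_left (h24 i)
  exists_unit_squares t := by
    have key (i : ι) : ∃ r : Fin 4 → (K i)ˣ,
        24 * t i = (r 0 : K i) ^ 2 - (r 1 : K i) ^ 2 + (r 2 : K i) ^ 2 - (r 3 : K i) ^ 2 ∧
          (t i ∈ A i → ∀ j, (r j : K i) ∈ A i ∧ ((r j)⁻¹ : K i) ∈ A i) := by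
      -- Solving inside `A i` whenever `t i` lies there keeps the four units and their inverses
      -- integral at almost all places, so they assemble to units of the restricted product.
      by_cases ht : t i ∈ A i
      · obtain ⟨r, hr⟩ := IsLocalRing.exists_unit_squares (⟨t i, ht⟩ : A i)
        exact ⟨fun j => Units.map (A i).subtype.toMonoidHom (r j),
          congrArg (A i).subtype hr, fun _ j => ValuationSubring.coe_unit_mem (r j)⟩
      · obtain ⟨r, hr⟩ := IsLocalRing.exists_unit_squares (t i)
        exact ⟨r, hr, fun h => absurd h ht⟩
    choose r hr hr' using key
    have hu (j : Fin 4) : ∀ᶠ i in Filter.cofinite,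
        (r i j : K i) ∈ A i ∧ ((r i j)⁻¹ : K i) ∈ A i :=
      t.2.mono fun i hi => hr' i hi j
    exact ⟨restrictedProductUnit _ (hu 0), restrictedProductUnit _ (hu 1),
      restrictedProductUnit _ (hu 2), restrictedProductUnit _ (hu 3),
      RestrictedProduct.ext _ _ hr⟩
  exists_finite := exists_finite_of_isUnit_two h2
  exists_isUnit a b c d hd := by
    have hd' (i : ι) : a i * d i - b i * c i = 1 :=
      congrArg (fun x : Πʳ i, [K i, A i] => x i) hd
    have key (i : ι) : ∃ (e : K i) (u : (K i)ˣ), (u : K i) = c i - e * a i ∧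
        (a i ∈ A i ∧ b i ∈ A i ∧ c i ∈ A i ∧ d i ∈ A i →
          e ∈ A i ∧ (u : K i) ∈ A i ∧ ((u)⁻¹ : K i) ∈ A i) := by
      by_cases h : a i ∈ A i ∧ b i ∈ A i ∧ c i ∈ A i ∧ d i ∈ A i
      · obtain ⟨ha, hb, hc, hd⟩ := h
        obtain ⟨e, u, hu⟩ := IsLocalRing.exists_isUnit_sub_mul (⟨a i, ha⟩ : A i) ⟨b i, hb⟩
          ⟨c i, hc⟩ ⟨d i, hd⟩ (Subtype.ext (hd' i))
        exact ⟨e, Units.map (A i).subtype.toMonoidHom u, congrArg (A i).subtype hu,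
          fun _ => ⟨e.2, ValuationSubring.coe_unit_mem u⟩⟩
      · obtain ⟨e, u, hu⟩ := IsLocalRing.exists_isUnit_sub_mul (a i) (b i) (c i) (d i) (hd' i)
        exact ⟨e, u, hu, fun h' => absurd h' h⟩
    choose e u hu hu' using key
    have hall := a.2.and (b.2.and (c.2.and d.2))
    refine ⟨⟨e, hall.mono fun i hi => (hu' i hi).1⟩,
      restrictedProductUnit u (hall.mono fun i hi => (hu' i hi).2), ?_⟩
    exact RestrictedProduct.ext _ _ hu

end RestrictedProducts

/-! ### Number fields -/

section NumberField

variable (K : Type*) [Field K] [NumberField K]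

theorem ofNat_ne_zero_of_ringHom {F : Type*} [Field F] {n : ℕ} [NeZero n] (f : K →+* F) :
    (n : F) ≠ 0 := by
  rw [← map_natCast f, Ne, map_eq_zero]
  exact_mod_cast NeZero.ne n

variable {K}

/-- Modulo `2`, every local integer is congruent to a global one, so the finite ring `𝓞 K ⧸ (2)`
supplies representatives. -/
theorem exists_finite_adicCompletionIntegers (v : HeightOneSpectrum (𝓞 K)) :
    ∃ S : Set (v.adicCompletionIntegers K), S.Finite ∧ ∀ a, ∃ c ∈ S, ∃ b, a = c + 2 * b := by
  have hfin : Finite (𝓞 K ⧸ Ideal.span {(2 : 𝓞 K)}) :=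
    Ideal.finiteQuotientOfFreeOfNeBot _ (by simp)
  refine ⟨Set.range fun q : 𝓞 K ⧸ Ideal.span {(2 : 𝓞 K)} => algebraMap (𝓞 K) _ q.out,
    Set.finite_range _, fun a => ?_⟩
  have h20 : (2 : v.adicCompletion K) ≠ 0 := by
    have := ofNat_ne_zero_of_ringHom K (n := 2) (algebraMap K (v.adicCompletion K))
    exact_mod_cast this
  have hv2 : Valued.v (2 : v.adicCompletion K) ≠ 0 := (Valuation.ne_zero_iff _).2 h20
  have hv2' : Valued.v (2 : v.adicCompletion K) ≤ 1 := by
    have := (2 : v.adicCompletionIntegers K).2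
    rwa [HeightOneSpectrum.mem_adicCompletionIntegers] at this
  have ha : Valued.v (a : v.adicCompletion K) ≤ 1 := a.2
  -- Density of `K` gives an `x` congruent to `a` modulo `2` locally. This `x` is integral at `v`,
  -- so it can be approximated by some `r` in `𝓞 K`, which is then reduced modulo `2`.
  obtain ⟨x, hx⟩ : ∃ x : K, Valued.v ((x : v.adicCompletion K) - a) ≤
      Valued.v (2 : v.adicCompletion K) := by
    have hcont : Continuous fun y : v.adicCompletion K => (y - a) / 2 := by fun_prop
    obtain ⟨x, hx⟩ := HeightOneSpectrum.denseRange_algebraMap K v |>.exists_mem_open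
      ((Valued.isOpen_valuationSubring (v.adicCompletion K)).preimage hcont) ⟨a, by simp⟩
    refine ⟨x, ?_⟩
    have hx' : Valued.v (((x : v.adicCompletion K) - a) / 2) ≤ 1 := hx
    rwa [map_div₀, div_le_one₀ (zero_lt_iff.2 hv2)] at hx'
  have hx1 : v.valuation K x ≤ 1 := by
    rw [← HeightOneSpectrum.valuedAdicCompletion_eq_valuation', ← sub_add_cancel (x : v.adicCompletion K) a]
    exact (Valuation.map_add _ _ _).trans (max_le (hx.trans hv2') ha)
  obtain ⟨r, hr⟩ := HeightOneSpectrum.exists_valuation_sub_lt_of_integer v hx1 (Units.mk0 _ hv2)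
  obtain ⟨s, hs⟩ : ∃ s, r = (Ideal.Quotient.mk (Ideal.span {(2 : 𝓞 K)}) r).out + 2 * s := by
    have := Ideal.Quotient.eq.1
      (Quotient.out_eq' (Ideal.Quotient.mk (Ideal.span {(2 : 𝓞 K)}) r)).symm
    obtain ⟨s, hs⟩ := Ideal.mem_span_singleton.1 this
    exact ⟨s, by rw [← hs]; ring⟩
  have hb : ((a : v.adicCompletion K) - algebraMap (𝓞 K) (v.adicCompletionIntegers K) r) / 2 ∈
      v.adicCompletionIntegers K := by
    rw [HeightOneSpectrum.mem_adicCompletionIntegers, map_div₀]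
    refine div_le_one_of_le₀ ?_ zero_le
    rw [HeightOneSpectrum.algebraMap_adicCompletionIntegers_apply, Valuation.map_sub_swap]
    have h3 : ((algebraMap (𝓞 K) K r : K) : v.adicCompletion K) - a =
      ((algebraMap (𝓞 K) K r - x : K) : v.adicCompletion K) + ((x : v.adicCompletion K) - a) := by
      have h4 : ((algebraMap (𝓞 K) K r - x : K) : v.adicCompletion K) =
        ((algebraMap (𝓞 K) K r : K) : v.adicCompletion K) - (x : v.adicCompletion K) :=
        map_sub (algebraMap K (v.adicCompletion K)) _ _
      rw [h4, sub_add_sub_cancel]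
    rw [h3]
    refine (Valuation.map_add _ _ _).trans (max_le ?_ hx)
    rw [HeightOneSpectrum.valuedAdicCompletion_eq_valuation']
    exact hr.le
  refine ⟨_, ⟨Ideal.Quotient.mk _ r, rfl⟩, algebraMap (𝓞 K) _ s + ⟨_, hb⟩, Subtype.ext ?_⟩
  have hs' := congrArg (fun y => ((algebraMap (𝓞 K) (v.adicCompletionIntegers K) y :
    v.adicCompletionIntegers K) : v.adicCompletion K)) hs
  simp only [map_add, map_mul, map_ofNat] at hs'
  push_cast at hs' ⊢
  have h22 : ((2 : v.adicCompletionIntegers K) : v.adicCompletion K) = 2 := rfl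
  rw [h22] at hs' ⊢
  rw [mul_add, mul_div_cancel₀ _ h20]
  linear_combination hs'

/-- If `2` is not a unit at `v`, then `2⁻¹` has a pole at `v`, which happens at finitely many places
only. -/
theorem finite_setOf_not_isUnit_two :
    {v : HeightOneSpectrum (𝓞 K) | ¬IsUnit (2 : v.adicCompletionIntegers K)}.Finite := by
  refine (HeightOneSpectrum.Support.finite (𝓞 K) (2⁻¹ : K)).subset fun v hv => ?_
  by_contra h
  have h1 : v.valuation K (2⁻¹ : K) ≤ 1 := not_lt.1 h
  have h2 : ((2⁻¹ : K) : v.adicCompletion K) ∈ v.adicCompletionIntegers K := by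
    rw [HeightOneSpectrum.mem_adicCompletionIntegers,
      HeightOneSpectrum.valuedAdicCompletion_eq_valuation']
    exact h1
  refine hv (IsUnit.of_mul_eq_one ⟨_, h2⟩ (Subtype.ext ?_))
  have h3 : (algebraMap K (v.adicCompletion K)) 2 * algebraMap K (v.adicCompletion K) 2⁻¹ = 1 := by
    rw [← map_mul, mul_inv_cancel₀ two_ne_zero, map_one]
  rw [map_ofNat] at h3
  exact h3

theorem unitSquareRing_completion (v : NumberField.InfinitePlace K) :
    UnitSquareRing v.Completion :=
  .of_field (by exact_mod_cast ofNat_ne_zero_of_ringHom K (n := 24) (algebraMap K v.Completion))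

theorem twentyFour_ne_zero_adicCompletion (v : HeightOneSpectrum (𝓞 K)) :
    (24 : v.adicCompletion K) ≠ 0 := by
  exact_mod_cast ofNat_ne_zero_of_ringHom K (n := 24) (algebraMap K (v.adicCompletion K))

theorem unitSquareRing_adicCompletionIntegers (v : HeightOneSpectrum (𝓞 K)) :
    UnitSquareRing (v.adicCompletionIntegers K) :=
  .of_isLocalRing (fun h => twentyFour_ne_zero_adicCompletion v (congrArg Subtype.val h))
    (exists_finite_adicCompletionIntegers v)

theorem unitSquareRing_adeleRing : UnitSquareRing (NumberField.AdeleRing (𝓞 K) K) := by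
  refine UnitSquareRing.prod (R := NumberField.InfiniteAdeleRing K)
    (S := FiniteAdeleRing (𝓞 K) K) ?_ ?_
  · exact UnitSquareRing.pi (O := fun v : NumberField.InfinitePlace K => v.Completion)
      unitSquareRing_completion (Set.toFinite _)
  · refine UnitSquareRing.restrictedProduct (K := fun v : HeightOneSpectrum (𝓞 K) =>
      v.adicCompletion K) (A := fun v => v.adicCompletionIntegers K)
      twentyFour_ne_zero_adicCompletion ?_
    -- Although `2` fails to be a unit in some local integer rings, it is the image of a unit of `K`
    -- in the finite adeles.
    have h : IsUnit (2 : FiniteAdeleRing (𝓞 K) K) := by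
      rw [← map_ofNat (algebraMap K (FiniteAdeleRing (𝓞 K) K)) 2]
      exact (IsUnit.mk0 _ two_ne_zero).map _
    exact h

theorem unitSquareRing_nfLocalRing (v : NFPlace K) : UnitSquareRing (NFLocalRing K v) :=
  match v with
  | .inl v => unitSquareRing_completion v
  | .inr v => unitSquareRing_adicCompletionIntegers v

theorem unitSquareRing_pi_nfLocalRing (P : Set (NFPlace K)) :
    UnitSquareRing (∀ v : P, NFLocalRing K v.1) := by
  refine UnitSquareRing.pi (fun v => unitSquareRing_nfLocalRing v.1) ?_
  have h : {v : NFPlace K | ¬IsUnit (2 : NFLocalRing K v)}.Finite := by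
    refine ((Set.toFinite (Set.range Sum.inl)).union
      (finite_setOf_not_isUnit_two.image Sum.inr)).subset ?_
    rintro (v | v) hv
    · exact Or.inl ⟨v, rfl⟩
    · exact Or.inr ⟨v, hv, rfl⟩
  exact h.preimage Subtype.val_injective.injOn

end NumberField

/-! ### Function fields -/

section FunctionField

variable {F : Type*} [Field F] [Finite F] {K : Type*} [Field K] [Algebra (RatFunc F) K]

theorem exists_natCast_mul_two_eq_one (F : Type*) [Field F] [Finite F] {K : Type*} [Field K]
    [Algebra (RatFunc F) K] (h2 : ringChar K ≠ 2) : ∃ n : ℕ, (2 : K) * n = 1 := by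
  have : CharP K (ringChar F) := by
    have f : F →+* K := (algebraMap (RatFunc F) K).comp (algebraMap F (RatFunc F))
    exact charP_of_injective_ringHom f.injective _
  have hp : (ringChar F).Prime := CharP.char_prime_of_ne_zero F (CharP.ringChar_ne_zero_of_finite F)
  have hK : ringChar K = ringChar F := ringChar.eq K _
  rw [hK] at h2
  obtain ⟨m, hm⟩ := hp.odd_of_ne_two h2
  -- The characteristic is `2 * m + 1`, so `2 * (m + 1) = 1`. A natural number as inverse of `2` is
  -- integral at every place and compatible with all the ring maps.
  refine ⟨m + 1, ?_⟩
  have := CharP.cast_eq_zero K (ringChar F)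
  rw [hm] at this
  push_cast at this ⊢
  linear_combination this

theorem twentyFour_ne_zero_of_ringChar (h2 : ringChar K ≠ 2)
    (h3 : ringChar K ≠ 3) : (24 : K) ≠ 0 := by
  have h2' : (2 : K) ≠ 0 := Ring.two_ne_zero h2
  have h3' : (3 : K) ≠ 0 := by
    intro h
    have h : ((3 : ℕ) : K) = 0 := by exact_mod_cast h
    rcases (Nat.dvd_prime Nat.prime_three).1 ((ringChar.spec K 3).1 h) with h | h
    · exact CharP.ringChar_ne_one h
    · exact h3 h
  rw [show (24 : K) = 2 * 2 * 2 * 3 by norm_num]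
  simp [h2', h3']

theorem twentyFour_ne_zero_ffCompletion (h24 : (24 : K) ≠ 0) (v : FFPlace K) :
    (24 : FFCompletion v) ≠ 0 := by
  let f : K →+* FFCompletion v :=
    UniformSpace.Completion.coeRingHom.comp (WithVal.equiv v.1.valuation).symm.toRingHom
  rw [← map_ofNat f 24, Ne, map_eq_zero]
  exact h24

theorem ffCompletion_mul_eq_one (v : FFPlace K) {n : ℕ} (hn : (2 : K) * n = 1) :
    (2 : FFCompletion v) * n = 1 := by
  let f : K →+* FFCompletion v :=
    UniformSpace.Completion.coeRingHom.comp (WithVal.equiv v.1.valuation).symm.toRingHom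
  rw [← map_ofNat f 2, ← map_natCast f, ← map_mul, hn, map_one]

theorem unitSquareRing_ffAdeleRing (h24 : (24 : K) ≠ 0) {n : ℕ} (hn : (2 : K) * n = 1) :
    UnitSquareRing (FFAdeleRing K) := by
  refine @UnitSquareRing.restrictedProduct (FFPlace K) (fun v => FFCompletion v)
    (fun _ => inferInstance) (fun v => ffIntegers v) (twentyFour_ne_zero_ffCompletion h24) ?_
  refine IsUnit.of_mul_eq_one (n : FFAdeleRing K) (RestrictedProduct.ext _ _ fun v => ?_)
  exact ffCompletion_mul_eq_one v hn

theorem unitSquareRing_pi_ffIntegers (h24 : (24 : K) ≠ 0) {n : ℕ} (hn : (2 : K) * n = 1)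
    (P : Set (FFPlace K)) : UnitSquareRing (∀ v : P, ffIntegers v.1) := by
  have h2 (v : FFPlace K) : IsUnit (2 : ffIntegers v) :=
    IsUnit.of_mul_eq_one (n : ffIntegers v) (Subtype.ext (ffCompletion_mul_eq_one v hn))
  refine .pi (fun v => .of_isLocalRing
    (fun h => twentyFour_ne_zero_ffCompletion h24 v.1 (congrArg Subtype.val h))
    (exists_finite_of_isUnit_two (h2 v.1))) ?_
  convert! Set.finite_empty
  rw [Set.eq_empty_iff_forall_notMem]
  exact fun v hv => hv (h2 v.1)

end FunctionField

end AdelicSL2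

theorem theorem1 :
    (∀ (K : Type*) [Field K] [NumberField K],
      AdelicSL2.BiInterpretableWithSL2 (NumberField.AdeleRing (NumberField.RingOfIntegers K) K) ∧
      ∀ P : Set (AdelicSL2.NFPlace K), P.Nonempty →
        AdelicSL2.BiInterpretableWithSL2 (∀ v : P, AdelicSL2.NFLocalRing K v.1)) ∧
    (∀ (F : Type*) [Field F] [Finite F] (K : Type*) [Field K] [Algebra (RatFunc F) K]
      [FunctionField F K], ringChar K ≠ 2 → ringChar K ≠ 3 → ringChar K ≠ 5 →
      AdelicSL2.BiInterpretableWithSL2 (AdelicSL2.FFAdeleRing K) ∧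
      ∀ P : Set (AdelicSL2.FFPlace K), P.Nonempty →
        AdelicSL2.BiInterpretableWithSL2 (∀ v : P, AdelicSL2.ffIntegers v.1)) := by
  refine ⟨fun K _ _ => ⟨AdelicSL2.unitSquareRing_adeleRing.biInterpretableWithSL2, fun P _ =>
    (AdelicSL2.unitSquareRing_pi_nfLocalRing P).biInterpretableWithSL2⟩, ?_⟩
  intro F _ _ K _ _ _ h2 h3 _
  have h24 : (24 : K) ≠ 0 := AdelicSL2.twentyFour_ne_zero_of_ringChar h2 h3
  obtain ⟨n, hn⟩ := AdelicSL2.exists_natCast_mul_two_eq_one F h2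
  exact ⟨(AdelicSL2.unitSquareRing_ffAdeleRing h24 hn).biInterpretableWithSL2, fun P _ =>
    (AdelicSL2.unitSquareRing_pi_ffIntegers h24 hn P).biInterpretableWithSL2⟩
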